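/- Let $H$ be a separable infinite-dimensional complex Hilbert space. A \emph{normed ideal} of $\mathcal{B}(H)$ is a two-sided ideal $\mathcal{J}$ of $\mathcal{B}(H)$ with a norm $\|\cdot\|_{\mathcal J}$ making it a Banach space, containing all rank one operators, such that $\|X\|_{\mathcal J}=\|X\|$ for every rank one operator $X$ and $\|YXZ\|_{\mathcal J}\le\|Y\|\,\|X\|_{\mathcal J}\,\|Z\|$ for $X\in\mathcal J$ and $Y,Z\in\mathcal B(H)$ (the case $\mathcal J=\mathcal B(H)$ is allowed). A continuous function $f:[c,d]\to\mathbb R$ is \emph{$\mathcal J$-Lipschitz on $[c,d]$} if there is $C>0$ such that for all self-adjoint $A_1,A_2\in\mathcal B(H)$ with spectra in $[c,d]$ and $A_1-A_2\in\mathcal J$ one has $f(A_1)-f(A_2)\in\mathcal J$ and $\|f(A_1)-f(A_2)\|_{\mathcal J}\le C\|A_1-A_2\|_{\mathcal J}$. Let $0\le a<b$ and let $\varphi=(\varphi_1,\varphi_2)$ be a pair of continuous non-decreasing real functions on $[a,b]$ such that $\varphi_1+\varphi_2$ is strictly increasing. For $X\in\mathcal B(H)$ with $\sigma(|X|),\sigma(|X^*|)\subset[a,b]$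 put $\varphi(X)=\varphi_1(|X|)-\varphi_2(|X^*|)$. Let $\mathcal J$ be a normed ideal of $\mathcal B(H)$ and let $T\in\mathcal B(H)$. Assume: (1) if $a>0$, then $\varphi_1$ and $\varphi_2$ are $\mathcal J$-Lipschitz on $[a,b]$ and $\sigma(|T|),\sigma(|T^*|)\subset(a,b)$; (2) if $a=0$, then the even extensions $x\mapsto\varphi_1(|x|)$ and $x\mapsto\varphi_2(|x|)$ are $\mathcal J$-Lipschitz on $[-b,b]$ and $\sigma(|T|),\sigma(|T^*|)\subset[0,b)$; (3) $[\varphi(T),T]\in\mathcal J$. Then there is a unique map $X:[0,\infty)\to\mathcal B(H)$ with $\sigma(|X(t)|),\sigma(|X(t)^*|)\subset[a,b]$ for all $t\ge0$ such that $$\frac{dX(t)}{dt}=[\varphi(X(t)),X(t)]\quad(t\ge 0),\qquad X(0)=T$$ (derivative in the operator norm), and $X(t)-T\in\mathcal J$ for all $t\geq 0$ with $t\mapsto X(t)-T$ in $C^1([0,\infty),\mathcal J)$, where $\mathcal J$ carries the norm $\|\cdot\|_{\mathcal J}$. For every $t\ge0$, $X(t)$ lies in the similarity orbit $\mathcal O(T)=\{gTg^{-1}: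 g\in\mathcal B(H)\text{ invertible}\}$. If moreover $\varphi(T)\in\mathcal J$, then for every $t\ge0$, $X(t)$ lies in $\mathcal O_{\mathcal J}(T)=\{gTg^{-1}: g\in\mathcal B(H)\text{ invertible},\ g-I\in\mathcal J\}$. -/

import Mathlib

open Set
open scoped Topology

noncomputable section

/-- A normed ideal of `B(H)`: a two-sided ideal `J` (a linear subspace closed under multiplication
by bounded operators on both sides) with a complete norm `‖·‖_J`, containing every
rank one operator `X` with `‖X‖_J = ‖X‖`, and satisfying `‖Y X Z‖_J ≤ ‖Y‖ ‖X‖_J ‖Z‖`.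
The case `J = B(H)` is allowed. -/
structure NormedIdeal (H : Type*) [NormedAddCommGroup H] [InnerProductSpace ℂ H] where
  toSubmodule : Submodule ℂ (H →L[ℂ] H)
  mul_mem : ∀ (Y : H →L[ℂ] H) {X : H →L[ℂ] H} (Z : H →L[ℂ] H),
    X ∈ toSubmodule → Y * X * Z ∈ toSubmodule
  /-- the norm `‖·‖_J` -/
  nrm : toSubmodule → ℝ
  nrm_nonneg : ∀ X, 0 ≤ nrm X
  nrm_eq_zero : ∀ X, nrm X = 0 ↔ X = 0
  nrm_smul : ∀ (c : ℂ) X, nrm (c • X) = ‖c‖ * nrm X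
  nrm_add_le : ∀ X Y, nrm (X + Y) ≤ nrm X + nrm Y
  /-- every sequence that is Cauchy for `‖·‖_J` converges for `‖·‖_J` to an element of `J` -/
  complete : ∀ u : ℕ → toSubmodule,
    (∀ ε : ℝ, 0 < ε → ∃ N, ∀ m, N ≤ m → ∀ n, N ≤ n → nrm (u m - u n) < ε) →
    ∃ X : toSubmodule, ∀ ε : ℝ, 0 < ε → ∃ N, ∀ n, N ≤ n → nrm (u n - X) < ε
  rankOne_mem : ∀ X : H →L[ℂ] H, Module.finrank ℂ (LinearMap.range (X : H →ₗ[ℂ] H)) = 1 →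
    X ∈ toSubmodule
  nrm_rankOne : ∀ X : toSubmodule,
    Module.finrank ℂ (LinearMap.range ((X : H →L[ℂ] H) : H →ₗ[ℂ] H)) = 1 →
    nrm X = ‖(X : H →L[ℂ] H)‖
  nrm_mul_le : ∀ (Y : H →L[ℂ] H) (X : toSubmodule) (Z : H →L[ℂ] H),
    nrm ⟨Y * (X : H →L[ℂ] H) * Z, mul_mem Y Z X.2⟩ ≤ ‖Y‖ * nrm X * ‖Z‖

namespace NormedIdeal

variable {H : Type*} [NormedAddCommGroup H] [InnerProductSpace ℂ H]

/-- The Banach space `(J, ‖·‖_J)`. This is a copy of the subspace `J`, so that it carries `‖·‖_J`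
and not the operator norm. -/
def Space (J : NormedIdeal H) : Type _ := J.toSubmodule

namespace Space

variable (J : NormedIdeal H)

instance : AddCommGroup J.Space := inferInstanceAs (AddCommGroup J.toSubmodule)

instance : Module ℂ J.Space := inferInstanceAs (Module ℂ J.toSubmodule)

instance : Norm J.Space := ⟨J.nrm⟩

theorem core : NormedSpace.Core ℂ J.Space where
  norm_nonneg := J.nrm_nonneg
  norm_smul := J.nrm_smul
  norm_triangle := J.nrm_add_le
  norm_eq_zero_iff := J.nrm_eq_zero

instance : NormedAddCommGroup J.Space := NormedAddCommGroup.ofCore (core J)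

instance : NormedSpace ℂ J.Space := NormedSpace.ofCore (core J)

/-- The inclusion of `J` into `B(H)`. -/
def val {J : NormedIdeal H} (Z : J.Space) : H →L[ℂ] H := Subtype.val (p := (· ∈ J.toSubmodule)) Z

instance : CompleteSpace J.Space := by
  refine Metric.complete_of_cauchySeq_tendsto fun u hu => ?_
  obtain ⟨X, hX⟩ := J.complete u fun ε hε => by
    obtain ⟨N, hN⟩ := Metric.cauchySeq_iff.1 hu ε hε
    refine ⟨N, fun m hm n hn => ?_⟩
    have h := hN m hm n hn
    rw [dist_eq_norm] at h
    exact h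
  let X' : J.Space := X
  refine ⟨X', Metric.tendsto_atTop.2 fun ε hε => ?_⟩
  obtain ⟨N, hN⟩ := hX ε hε
  refine ⟨N, fun n hn => ?_⟩
  rw [dist_eq_norm]
  exact hN n hn

end Space

/-- A map `ψ` is `J`-Lipschitz on a set `S` of operators. -/
def LipschitzMapOn (J : NormedIdeal H) (ψ : (H →L[ℂ] H) → (H →L[ℂ] H))
    (S : Set (H →L[ℂ] H)) : Prop :=
  ∃ C : ℝ, 0 < C ∧ ∀ X₁ ∈ S, ∀ X₂ ∈ S, ∀ h : X₁ - X₂ ∈ J.toSubmodule,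
    ∃ h' : ψ X₁ - ψ X₂ ∈ J.toSubmodule,
      J.nrm ⟨ψ X₁ - ψ X₂, h'⟩ ≤ C * J.nrm ⟨X₁ - X₂, h⟩

/-- The similarity orbit `{g T g⁻¹ : g ∈ B(H) invertible, g - 1 ∈ J}`. -/
def orbit (J : NormedIdeal H) (T : H →L[ℂ] H) : Set (H →L[ℂ] H) :=
  {Y | ∃ g : (H →L[ℂ] H)ˣ, (g : H →L[ℂ] H) - 1 ∈ J.toSubmodule ∧
    Y = (g : H →L[ℂ] H) * T * ((g⁻¹ : (H →L[ℂ] H)ˣ) : H →L[ℂ] H)}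

end NormedIdeal

/-- The similarity orbit `{g T g⁻¹ : g ∈ B(H) invertible}`. -/
def similarityOrbit {H : Type*} [NormedAddCommGroup H] [InnerProductSpace ℂ H]
    (T : H →L[ℂ] H) : Set (H →L[ℂ] H) :=
  {Y | ∃ g : (H →L[ℂ] H)ˣ,
    Y = (g : H →L[ℂ] H) * T * ((g⁻¹ : (H →L[ℂ] H)ˣ) : H →L[ℂ] H)}

/-- Condition (C0) for a pair of continuous real functions on `[a, b]`
(only the values on `[a, b]` matter). -/
structure ConditionC0 (a b : ℝ) (φ₁ φ₂ : ℝ → ℝ) : Prop where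
  continuousOn_fst : ContinuousOn φ₁ (Icc a b)
  continuousOn_snd : ContinuousOn φ₂ (Icc a b)
  monotoneOn_fst : MonotoneOn φ₁ (Icc a b)
  monotoneOn_snd : MonotoneOn φ₂ (Icc a b)
  strictMonoOn_add : StrictMonoOn (fun x => φ₁ x + φ₂ x) (Icc a b)

section Operators

variable {H : Type*} [NormedAddCommGroup H] [InnerProductSpace ℂ H] [CompleteSpace H]

variable (H) in
/-- The self-adjoint operators with spectrum in `[a, b]`. -/
def selfAdjointIcc (a b : ℝ) : Set (H →L[ℂ] H) :=
  {A | IsSelfAdjoint A ∧ spectrum ℝ A ⊆ Icc a b}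

/-- `f` is a `J`-Lipschitz function on `[a, b]`: it is continuous there and `A ↦ f(A)`
(continuous functional calculus) is `J`-Lipschitz on the self-adjoint operators with spectrum
in `[a, b]`. -/
def NormedIdeal.LipschitzFunctionOn (J : NormedIdeal H) (f : ℝ → ℝ) (a b : ℝ) : Prop :=
  ContinuousOn f (Icc a b) ∧ J.LipschitzMapOn (fun A => cfc f A) (selfAdjointIcc H a b)

/-- `φ(X) = φ₁(|X|) - φ₂(|X*|)`, where `|X| = (X* X)^{1/2}`. -/
def opPhi (φ₁ φ₂ : ℝ → ℝ) (X : H →L[ℂ] H) : H →L[ℂ] H :=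
  cfc φ₁ (CFC.abs X) - cfc φ₂ (CFC.abs (star X))

/-- `X`, restricted to `[0, ∞)`, is a global solution of `X' = [φ(X), X]`, `X(0) = T` (derivative
in the operator norm, one-sided at `0`) that stays where `φ` is defined, i.e.
`σ(|X(t)|), σ(|X(t)*|) ⊆ [a, b]`, and with `X - T ∈ C¹([0, ∞), J)` for the norm `‖·‖_J`. -/
structure IsGlobalSolution (J : NormedIdeal H) (a b : ℝ) (φ₁ φ₂ : ℝ → ℝ) (T : H →L[ℂ] H)
    (X : ℝ → (H →L[ℂ] H)) : Prop where
  initial : X 0 = T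
  spectrum_abs : ∀ t, 0 ≤ t → spectrum ℝ (CFC.abs (X t)) ⊆ Icc a b
  spectrum_abs_star : ∀ t, 0 ≤ t → spectrum ℝ (CFC.abs (star (X t))) ⊆ Icc a b
  hasDeriv : ∀ t, 0 ≤ t → HasDerivWithinAt X ⁅opPhi φ₁ φ₂ (X t), X t⁆ (Ici 0) t
  contDiff : ∃ Z : ℝ → J.Space, (∀ t, 0 ≤ t → (Z t).val = X t - T) ∧ ContDiffOn ℝ 1 Z (Ici 0)

end Operators

end

/-! The equation is solved inside the ideal: with `X = T + Z` it becomes an autonomous equation for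
`Z` in the Banach space `J.Space`, and everything rests on two facts.

The vector field is Lipschitz. The maps `X ↦ φᵢ(|X|)` are `J`-Lipschitz on operators with `a ≤ |X|,
|X*| ≤ b`. For `a > 0`, the difference `|X| - |Y|` is the solution of a Sylvester equation with
right-hand side `X*X - Y*Y`, which is solvable in the ideal. For `a = 0`, an isomorphism of `H` with
`H ⊕ H` makes `φ(|X|)` a corner of an even function of the self-adjoint matrix with off-diagonal
entries `X*` and `X`. The ideal and its norm are stable under adjoints, so `|X*|` is covered too.
Since `[φ(T), T]` lies in the ideal, so does the field.

The flow does not leave the domain. To first order in `h`, `W + h[φ(W), W]` is a product `(1 -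
hP₁)(1 + hB)W(1 - hP₂)`. At `s = ‖W‖`, monotonicity makes the outer factors contractions, and `B`, a
function of `|W*|` vanishing at `s`, cannot enlarge the norm to first order
(`eventually_norm_add_smul_lie_le`). Hence `‖X(t)‖` does not increase. When `a > 0`, the inverse
`X⁻¹` follows a flow of the same kind, so `‖X⁻¹‖` does not increase either. Together these bounds
make a closed annulus around `T` invariant (`annulus_of_flow`).

For global existence the field is multiplied by a cutoff equal to one on a smaller annulus
containing `T`. The product has global solutions which follow the flow up to a time change; by
invariance they stay where the cutoff is one, so they solve the original equation. Uniqueness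
follows from the Lipschitz bound. For the orbits, solving `g' = φ(X)g`, `g(0) = 1` gives `X =
gTg⁻¹`; if `φ(T)` is in the ideal, `g - 1` solves a linear equation in the ideal. -/

noncomputable section

/-! ### Normed ideals: comparison with the operator norm, and adjoints -/

/-- Douglas factorisation. -/
theorem exists_contraction_mul_eq {H : Type*} [NormedAddCommGroup H] [InnerProductSpace ℂ H]
    [CompleteSpace H] {A B : H →L[ℂ] H} (h : ∀ v, ‖A v‖ ≤ ‖B v‖) :
    ∃ C : H →L[ℂ] H, ‖C‖ ≤ 1 ∧ A = C * B := by
  let K : Submodule ℂ H := (LinearMap.range (B : H →ₗ[ℂ] H)).topologicalClosure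
  have hB : ∀ v, B v ∈ K := fun v => subset_closure ⟨v, rfl⟩
  let e : H →ₗ[ℂ] K := (B : H →ₗ[ℂ] H).codRestrict K hB
  have he : DenseRange e := by
    intro x
    have hx : (x : H) ∈ closure (LinearMap.range (B : H →ₗ[ℂ] H) : Set H) := x.2
    rw [closure_subtype]
    convert hx
    ext y
    constructor
    · rintro ⟨_, ⟨v, rfl⟩, rfl⟩
      exact ⟨v, rfl⟩
    · rintro ⟨v, rfl⟩
      exact ⟨_, ⟨v, rfl⟩, rfl⟩
  have hn : ∀ v, ‖(A : H →ₗ[ℂ] H) v‖ ≤ 1 * ‖e v‖ := fun v => by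
    rw [one_mul]
    exact h v
  let E : K →L[ℂ] H := (A : H →ₗ[ℂ] H).extendOfNorm e
  have : CompleteSpace K := (Submodule.isClosed_topologicalClosure _).completeSpace_coe
  refine ⟨E ∘L K.orthogonalProjectionOnto, ?_, ?_⟩
  · refine ContinuousLinearMap.opNorm_le_bound _ zero_le_one fun v => ?_
    refine (LinearMap.norm_extendOfNorm_apply_le he 1 hn _).trans ?_
    gcongr
    exact K.norm_orthogonalProjectionOnto_apply_le v
  · ext v
    have h1 : K.orthogonalProjectionOnto (B v) = e v :=
      K.orthogonalProjectionOnto_mem_subspace_eq_self ⟨B v, hB v⟩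
    change A v = E (K.orthogonalProjectionOnto (B v))
    rw [h1]
    exact (LinearMap.extendOfNorm_eq he ⟨1, hn⟩ v).symm

/-- Both squared norms equal `⟨X*X v, v⟩`. With Douglas factorisation in the two directions, this
serves as a polar decomposition. -/
theorem norm_cfcAbs_apply {H : Type*} [NormedAddCommGroup H] [InnerProductSpace ℂ H]
    [CompleteSpace H] (X : H →L[ℂ] H) (v : H) : ‖CFC.abs X v‖ = ‖X v‖ := by
  have hsa : star (CFC.abs X) = CFC.abs X := (CFC.abs_nonneg X).isSelfAdjoint
  have key : ∀ Y : H →L[ℂ] H, ((‖Y v‖ ^ 2 : ℝ) : ℂ) = inner ℂ ((star Y * Y) v) v := fun Y => by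
    rw [ContinuousLinearMap.star_eq_adjoint, mul_apply_eq_comp,
      ContinuousLinearMap.adjoint_inner_left, inner_self_eq_norm_sq_to_K]
    push_cast
    rfl
  have h : ((‖CFC.abs X v‖ ^ 2 : ℝ) : ℂ) = ((‖X v‖ ^ 2 : ℝ) : ℂ) := by
    rw [key, key, hsa, CFC.abs_mul_abs]
  exact (pow_left_inj₀ (norm_nonneg _) (norm_nonneg _) two_ne_zero).1 (Complex.ofReal_injective h)

namespace NormedIdeal

variable {H : Type*} [NormedAddCommGroup H] [InnerProductSpace ℂ H] {J : NormedIdeal H}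

namespace Space

theorem val_mem (Z : J.Space) : Z.val ∈ J.toSubmodule := Subtype.prop (p := (· ∈ J.toSubmodule)) Z

/-- An element of the ideal, as a point of the Banach space `J.Space`. -/
def mk (X : H →L[ℂ] H) (h : X ∈ J.toSubmodule) : J.Space := (⟨X, h⟩ : J.toSubmodule)

@[simp] theorem val_mk (X : H →L[ℂ] H) (h : X ∈ J.toSubmodule) : (mk X h).val = X := rfl

theorem val_injective : Function.Injective (val (J := J)) := fun _ _ h => Subtype.ext h

@[simp] theorem val_add (Z W : J.Space) : (Z + W).val = Z.val + W.val := rfl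
@[simp] theorem val_sub (Z W : J.Space) : (Z - W).val = Z.val - W.val := rfl
@[simp] theorem val_zero : (0 : J.Space).val = 0 := rfl
@[simp] theorem val_smul (c : ℂ) (Z : J.Space) : (c • Z).val = c • Z.val := rfl

/-- Two-sided multiplication by bounded operators. -/
def sandwich (Y : H →L[ℂ] H) (Z : J.Space) (W : H →L[ℂ] H) : J.Space :=
  mk (Y * Z.val * W) (J.mul_mem Y W Z.val_mem)

@[simp] theorem val_sandwich (Y : H →L[ℂ] H) (Z : J.Space) (W : H →L[ℂ] H) :
    (sandwich Y Z W).val = Y * Z.val * W := rfl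

theorem norm_sandwich_le (Y : H →L[ℂ] H) (Z : J.Space) (W : H →L[ℂ] H) :
    ‖sandwich Y Z W‖ ≤ ‖Y‖ * ‖Z‖ * ‖W‖ := J.nrm_mul_le Y Z W

/-- Left multiplication by a bounded operator. -/
def lmul (Y : H →L[ℂ] H) (Z : J.Space) : J.Space := sandwich Y Z 1

/-- Right multiplication by a bounded operator. -/
def rmul (Z : J.Space) (W : H →L[ℂ] H) : J.Space := sandwich 1 Z W

@[simp] theorem val_lmul (Y : H →L[ℂ] H) (Z : J.Space) : (lmul Y Z).val = Y * Z.val := by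
  simp [lmul]

@[simp] theorem val_rmul (Z : J.Space) (W : H →L[ℂ] H) : (rmul Z W).val = Z.val * W := by
  simp [rmul]

theorem norm_lmul_le (Y : H →L[ℂ] H) (Z : J.Space) : ‖lmul Y Z‖ ≤ ‖Y‖ * ‖Z‖ := by
  refine (norm_sandwich_le Y Z 1).trans (mul_le_of_le_one_right (by positivity) ?_)
  exact ContinuousLinearMap.norm_id_le

theorem norm_rmul_le (Z : J.Space) (W : H →L[ℂ] H) : ‖rmul Z W‖ ≤ ‖Z‖ * ‖W‖ := by
  refine (norm_sandwich_le 1 Z W).trans ?_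
  gcongr
  exact mul_le_of_le_one_left (norm_nonneg _) ContinuousLinearMap.norm_id_le

/-- For a unit vector `v`, composing `Z` with the projection onto `v` gives an operator of rank at
most one and norm `‖Z v‖`, on which the two norms agree. -/
theorem norm_val_le (Z : J.Space) : ‖Z.val‖ ≤ ‖Z‖ := by
  refine ContinuousLinearMap.opNorm_le_of_unit_norm (norm_nonneg _) fun v hv => ?_
  by_cases h0 : Z.val v = 0
  · rw [h0, norm_zero]
    exact norm_nonneg _
  have hv0 : v ≠ 0 := by
    rintro rfl
    simp at hv
  let P : H →L[ℂ] H := InnerProductSpace.rankOne ℂ v v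
  have hP : ‖P‖ = 1 := by simp [P, hv]
  have hval : (rmul Z P).val = InnerProductSpace.rankOne ℂ (Z.val v) v := by
    rw [val_rmul]
    ext w
    simp [P]
  have hrank : Module.finrank ℂ
      (LinearMap.range (((rmul Z P).val : H →L[ℂ] H) : H →ₗ[ℂ] H)) = 1 := by
    rw [hval, ← Module.rank_eq_one_iff_finrank_eq_one]
    exact InnerProductSpace.rank_rankOne h0 hv0
  have h1 : ‖rmul Z P‖ = ‖(rmul Z P).val‖ := J.nrm_rankOne (rmul Z P) hrank
  have h2 := norm_rmul_le Z P
  rw [h1, hval, hP, mul_one, InnerProductSpace.norm_rankOne, hv, mul_one] at h2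
  exact h2

/-- The inclusion `J → B(H)` as a contraction. -/
def valL : J.Space →L[ℂ] (H →L[ℂ] H) :=
  LinearMap.mkContinuous ⟨⟨val, val_add⟩, val_smul⟩ 1 fun Z => by
    rw [one_mul]
    exact norm_val_le Z

/-- With contractions `C`, `D` such that `|Z| = C Z` and `Z = D |Z|`, one has `Z* = |Z| D* = C Z
D*`. -/
theorem exists_val_eq_star [CompleteSpace H] (Z : J.Space) :
    ∃ W : J.Space, W.val = star Z.val ∧ ‖W‖ ≤ ‖Z‖ := by
  obtain ⟨C, hC, hCZ⟩ := exists_contraction_mul_eq (A := CFC.abs Z.val) (B := Z.val)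
    fun v => (norm_cfcAbs_apply _ v).le
  obtain ⟨D, hD, hDZ⟩ := exists_contraction_mul_eq (A := Z.val) (B := CFC.abs Z.val)
    fun v => (norm_cfcAbs_apply _ v).ge
  refine ⟨sandwich C Z (star D), ?_, ?_⟩
  · have hsa : star (CFC.abs Z.val) = CFC.abs Z.val := (CFC.abs_nonneg Z.val).isSelfAdjoint
    conv_rhs => rw [hDZ, star_mul, hsa, hCZ]
    rfl
  · refine (norm_sandwich_le _ _ _).trans ?_
    rw [norm_star]
    exact (mul_le_of_le_one_right (by positivity) hD).trans
      (mul_le_of_le_one_left (norm_nonneg _) hC)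

/-- The adjoint of an element of the ideal. -/
def adj [CompleteSpace H] (Z : J.Space) : J.Space := (exists_val_eq_star Z).choose

@[simp] theorem val_adj [CompleteSpace H] (Z : J.Space) : (adj Z).val = star Z.val :=
  (exists_val_eq_star Z).choose_spec.1

theorem norm_adj_le [CompleteSpace H] (Z : J.Space) : ‖adj Z‖ ≤ ‖Z‖ :=
  (exists_val_eq_star Z).choose_spec.2

end Space

end NormedIdeal

/-! ### Intertwining in the functional calculus, and annuli of operators -/

theorem aeval_mul_eq_mul_aeval {R : Type*} [Ring R] [Algebra ℝ R] {A B V : R} (h : A * V = V * B) (p : Polynomial ℝ) :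
    Polynomial.aeval A p * V = V * Polynomial.aeval B p := by
  induction p using Polynomial.induction_on' with
  | add p q hp hq => rw [map_add, map_add, add_mul, mul_add, hp, hq]
  | monomial n c =>
    have hn : A ^ n * V = V * B ^ n := by
      induction n with
      | zero => simp
      | succ n ih => rw [pow_succ, mul_assoc, h, ← mul_assoc, ih, mul_assoc, ← pow_succ]
    rw [Polynomial.aeval_monomial, Polynomial.aeval_monomial, mul_assoc, hn,
      ← mul_assoc, Algebra.commutes, mul_assoc]

section Functional

variable {H : Type*} [NormedAddCommGroup H] [InnerProductSpace ℂ H] [CompleteSpace H]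

/-- If `A V = V B` with `A`, `B` self-adjoint, then `f(A) V = V f(B)`. -/
theorem cfc_mul_eq_mul_cfc {A B V : H →L[ℂ] H} (h : A * V = V * B) {c d : ℝ} {f : ℝ → ℝ}
    (hf : ContinuousOn f (Icc c d)) (hA : A ∈ selfAdjointIcc H c d)
    (hB : B ∈ selfAdjointIcc H c d) : cfc f A * V = V * cfc f B := by
  rw [← sub_eq_zero, ← norm_le_zero_iff]
  refine le_of_forall_pos_le_add fun ε hε => ?_
  rw [zero_add]
  -- The two approximation errors contribute at most `2 η ‖V‖`, which stays below `ε`.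
  set η : ℝ := ε / (2 * (‖V‖ + 1)) with hη
  have hV : 0 ≤ ‖V‖ := norm_nonneg V
  have hη0 : 0 < η := by positivity
  obtain ⟨p, hp⟩ := exists_polynomial_near_of_continuousOn c d f hf η hη0
  have key : ∀ C : H →L[ℂ] H, C ∈ selfAdjointIcc H c d →
      ‖cfc f C - Polynomial.aeval C p‖ ≤ η := by
    rintro C ⟨hC, hs⟩
    have hfC : ContinuousOn f (spectrum ℝ C) := hf.mono hs
    rw [← cfc_polynomial p C, ← cfc_sub f p.eval C hfC p.continuous.continuousOn]
    refine norm_cfc_le hη0.le fun x hx => ?_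
    rw [norm_sub_rev]
    exact (hp x (hs hx)).le
  have e : cfc f A * V - V * cfc f B =
      (cfc f A - Polynomial.aeval A p) * V - V * (cfc f B - Polynomial.aeval B p) := by
    rw [sub_mul, mul_sub, aeval_mul_eq_mul_aeval h]
    abel
  have h1 : ‖(cfc f A - Polynomial.aeval A p) * V‖ ≤ η * ‖V‖ :=
    (norm_mul_le _ _).trans (by gcongr; exact key A hA)
  have h2 : ‖V * (cfc f B - Polynomial.aeval B p)‖ ≤ ‖V‖ * η :=
    (norm_mul_le _ _).trans (by gcongr; exact key B hB)
  rw [e]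
  refine (norm_sub_le _ _).trans ?_
  have h3 : η * (2 * (‖V‖ + 1)) = ε := div_mul_cancel₀ _ (by positivity)
  nlinarith

theorem cfcAbs_eq_cfc_sqrt (X : H →L[ℂ] H) : CFC.abs X = cfc Real.sqrt (star X * X) := by
  rw [CFC.abs, CFC.sqrt_eq_real_sqrt _ (star_mul_self_nonneg X),
    cfcₙ_eq_cfc (hf := Real.continuous_sqrt.continuousOn) (hf0 := Real.sqrt_zero)]

/-- Passing to `X*X` removes the square root, so that intertwining relations can be checked
algebraically. -/
theorem cfc_cfcAbs_eq {X : H →L[ℂ] H} {f : ℝ → ℝ}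
    (hf : ContinuousOn f (spectrum ℝ (CFC.abs X))) :
    cfc f (CFC.abs X) = cfc (fun x => f (√x)) (star X * X) := by
  have hs : IsSelfAdjoint (star X * X) := .star_mul_self X
  rw [cfcAbs_eq_cfc_sqrt] at hf ⊢
  rw [cfc_map_spectrum (R := ℝ) (hf := Real.continuous_sqrt.continuousOn) (ha := hs)] at hf
  exact (cfc_comp f Real.sqrt (star X * X) hs hf Real.continuous_sqrt.continuousOn).symm

/-- The operators `X` with `a ≤ |X| ≤ b` and `a ≤ |X*| ≤ b`, in terms of norms. -/
structure Annulus (a b : ℝ) (X : H →L[ℂ] H) : Prop where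
  norm_le : ‖X‖ ≤ b
  le_apply : ∀ v, a * ‖v‖ ≤ ‖X v‖
  le_star_apply : ∀ v, a * ‖v‖ ≤ ‖star X v‖

namespace Annulus

variable {a b : ℝ} {X Y : H →L[ℂ] H}

protected theorem star (h : Annulus a b X) : Annulus a b (star X) :=
  ⟨by rw [norm_star]; exact h.norm_le, h.le_star_apply, by rw [star_star]; exact h.le_apply⟩

theorem mono (h : Annulus a b X) {c d : ℝ} (hc : c ≤ a) (hd : b ≤ d) : Annulus c d X :=
  ⟨h.norm_le.trans hd, fun v => (by gcongr : c * ‖v‖ ≤ a * ‖v‖).trans (h.le_apply v),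
    fun v => (by gcongr : c * ‖v‖ ≤ a * ‖v‖).trans (h.le_star_apply v)⟩

theorem of_norm_sub_le (h : Annulus a b X) {δ : ℝ} (hδ : ‖Y - X‖ ≤ δ) :
    Annulus (a - δ) (b + δ) Y := by
  have key : ∀ A B : H →L[ℂ] H, ‖B - A‖ ≤ δ → (∀ v, a * ‖v‖ ≤ ‖A v‖) →
      ∀ v, (a - δ) * ‖v‖ ≤ ‖B v‖ := fun A B hBA hA v => by
    have h1 : ‖(B - A) v‖ ≤ δ * ‖v‖ := (B - A).le_of_opNorm_le hBA v
    have h2 : ‖A v‖ ≤ ‖B v‖ + ‖(B - A) v‖ := by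
      rw [show A v = B v - (B - A) v by simp]
      exact norm_sub_le _ _
    have := hA v
    nlinarith
  refine ⟨?_, key X Y hδ h.le_apply, key (star X) (star Y) ?_ h.le_star_apply⟩
  · have h1 : ‖Y‖ ≤ ‖X‖ + ‖Y - X‖ := by
      conv_lhs => rw [← add_sub_cancel X Y]
      exact norm_add_le _ _
    linarith [h.norm_le]
  · rw [← star_sub, norm_star]
    exact hδ

theorem of_nonpos (ha : a ≤ 0) (h : ‖X‖ ≤ b) : Annulus a b X :=
  ⟨h, fun _ => (mul_nonpos_of_nonpos_of_nonneg ha (norm_nonneg _)).trans (norm_nonneg _),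
    fun _ => (mul_nonpos_of_nonpos_of_nonneg ha (norm_nonneg _)).trans (norm_nonneg _)⟩

/-- The lower bound reads `a² ≤ X*X = |X|²` as an operator inequality; squares of spectral points of
`|X|` are spectral points of `|X|²`. -/
theorem spectrum_cfcAbs_subset (ha : 0 ≤ a) (h : Annulus a b X) :
    spectrum ℝ (CFC.abs X) ⊆ Icc a b := by
  have hn : 0 ≤ CFC.abs X := CFC.abs_nonneg X
  have hsa : IsSelfAdjoint (CFC.abs X) := hn.isSelfAdjoint
  intro x hx
  have hx0 : 0 ≤ x := spectrum_nonneg_of_nonneg hn hx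
  refine ⟨?_, ?_⟩
  · have h1 : algebraMap ℝ (H →L[ℂ] H) (a ^ 2) ≤ star X * X := by
      rw [ContinuousLinearMap.le_def]
      refine (ContinuousLinearMap.isPositive_def'.2 ⟨?_, fun v => ?_⟩)
      · exact IsSelfAdjoint.sub (.star_mul_self X) (.algebraMap _ (.all _))
      · have h2 := h.le_apply v
        have h3 : (a * ‖v‖) ^ 2 ≤ ‖X v‖ ^ 2 := by gcongr
        rw [ContinuousLinearMap.reApplyInnerSelf_apply, sub_apply,
          inner_sub_left, map_sub, Algebra.algebraMap_eq_smul_one,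
          ContinuousLinearMap.star_eq_adjoint, mul_apply_eq_comp,
          ContinuousLinearMap.adjoint_inner_left, inner_self_eq_norm_sq]
        have h4 : RCLike.re (inner ℂ ((a ^ 2 • (1 : H →L[ℂ] H)) v) v) = a ^ 2 * ‖v‖ ^ 2 := by
          rw [← inner_self_eq_norm_sq (𝕜 := ℂ) v]
          change RCLike.re (inner ℂ (a ^ 2 • v) v) = _
          rw [← Complex.coe_smul, inner_smul_left]
          simp [← Complex.ofReal_pow]
        rw [h4]
        nlinarith
    have h2 := (algebraMap_le_iff_le_spectrum (a := star X * X) (.star_mul_self X)).1 h1 (x ^ 2) (by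
      rw [← CFC.abs_sq]
      exact spectrum.pow_mem_pow _ 2 hx)
    exact (pow_le_pow_iff_left₀ ha hx0 two_ne_zero).1 h2
  · have h1 := spectrum.norm_le_norm_mul_of_mem hx
    rw [CFC.norm_abs] at h1
    have h2 : ‖X‖ * ‖(1 : H →L[ℂ] H)‖ ≤ ‖X‖ :=
      mul_le_of_le_one_right (norm_nonneg _) ContinuousLinearMap.norm_id_le
    exact (le_abs_self x).trans (h1.trans (h2.trans h.norm_le))

theorem cfcAbs_mem (ha : 0 ≤ a) (h : Annulus a b X) : CFC.abs X ∈ selfAdjointIcc H a b :=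
  ⟨(CFC.abs_nonneg X).isSelfAdjoint, h.spectrum_cfcAbs_subset ha⟩

theorem of_spectrum (ha : 0 ≤ a) (hb : 0 ≤ b) (h : spectrum ℝ (CFC.abs X) ⊆ Icc a b)
    (h' : spectrum ℝ (CFC.abs (star X)) ⊆ Icc a b) : Annulus a b X := by
  have key : ∀ Y : H →L[ℂ] H, spectrum ℝ (CFC.abs Y) ⊆ Icc a b → ∀ v, a * ‖v‖ ≤ ‖Y v‖ := by
    intro Y hY v
    have hn : 0 ≤ CFC.abs Y := CFC.abs_nonneg Y
    have h1 : algebraMap ℝ (H →L[ℂ] H) a ≤ CFC.abs Y :=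
      (algebraMap_le_iff_le_spectrum (hn.isSelfAdjoint)).2 fun x hx => (hY hx).1
    rw [ContinuousLinearMap.le_def] at h1
    have h2 := h1.re_inner_nonneg_left v
    rw [sub_apply, inner_sub_left, map_sub,
      Algebra.algebraMap_eq_smul_one] at h2
    have h4 : RCLike.re (inner ℂ ((a • (1 : H →L[ℂ] H)) v) v) = a * ‖v‖ ^ 2 := by
      rw [← inner_self_eq_norm_sq (𝕜 := ℂ) v]
      change RCLike.re (inner ℂ (a • v) v) = _
      rw [← Complex.coe_smul, inner_smul_left]
      simp
    have h5 := re_inner_le_norm (𝕜 := ℂ) (CFC.abs Y v) v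
    rw [norm_cfcAbs_apply] at h5
    rcases (norm_nonneg v).eq_or_lt with h0 | h0
    · rw [← h0, mul_zero]
      exact norm_nonneg _
    · have : a * ‖v‖ * ‖v‖ ≤ ‖Y v‖ * ‖v‖ := by nlinarith
      exact le_of_mul_le_mul_right this h0
  refine ⟨?_, key X h, key _ h'⟩
  have h1 : CFC.abs X = cfc id (CFC.abs X) :=
    (cfc_id ℝ (CFC.abs X) (CFC.abs_nonneg X).isSelfAdjoint).symm
  rw [← CFC.norm_abs, h1]
  refine norm_cfc_le hb fun x hx => ?_
  rw [id, Real.norm_of_nonneg (ha.trans (h hx).1)]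
  exact (h hx).2

/-- Both `X*X` and `XX*` are squares of invertible operators, which gives a left and a right inverse
of `X`. -/
theorem isUnit (ha : 0 < a) (h : Annulus a b X) : IsUnit X := by
  have key : ∀ Y : H →L[ℂ] H, spectrum ℝ (CFC.abs Y) ⊆ Icc a b → IsUnit (star Y * Y) := by
    intro Y hY
    have h1 : IsUnit (CFC.abs Y) := spectrum.zero_notMem_iff ℝ |>.1 fun h0 => by
      linarith [(hY h0).1]
    rw [← CFC.abs_mul_abs]
    exact h1.mul h1
  obtain ⟨u, hu⟩ := key X (h.spectrum_cfcAbs_subset ha.le)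
  obtain ⟨w, hw⟩ := key _ (h.star.spectrum_cfcAbs_subset ha.le)
  rw [star_star] at hw
  refine isUnit_iff_exists_and_exists.2 ⟨⟨star X * ↑w⁻¹, ?_⟩, ⟨↑u⁻¹ * star X, ?_⟩⟩
  · rw [← mul_assoc, ← hw, Units.mul_inv]
  · rw [mul_assoc, ← hu, Units.inv_mul]

theorem norm_inverse_le (ha : 0 < a) (h : Annulus a b X) : ‖Ring.inverse X‖ ≤ a⁻¹ := by
  refine ContinuousLinearMap.opNorm_le_bound _ (inv_nonneg.2 ha.le) fun v => ?_
  have h1 := h.le_apply (Ring.inverse X v)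
  rw [← mul_apply_eq_comp, Ring.mul_inverse_cancel X (h.isUnit ha),
    one_apply_eq_self] at h1
  rw [inv_mul_eq_div, le_div_iff₀ ha, mul_comm]
  exact h1

/-- One norm bound on the inverse yields both lower bounds, because the adjoint has the adjoint
inverse of the same norm. This is how a lower bound on `|X|` is propagated along the flow. -/
theorem of_norm_inverse_le (ha : 0 < a) (h : ‖X‖ ≤ b) (hX : IsUnit X)
    (hi : ‖Ring.inverse X‖ ≤ a⁻¹) : Annulus a b X := by
  have key : ∀ Y W : H →L[ℂ] H, W * Y = 1 → ‖W‖ ≤ a⁻¹ → ∀ v, a * ‖v‖ ≤ ‖Y v‖ := by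
    intro Y W hWY hW v
    have h1 := W.le_of_opNorm_le hW (Y v)
    rw [← mul_apply_eq_comp, hWY, one_apply_eq_self, inv_mul_eq_div, le_div_iff₀ ha,
      mul_comm] at h1
    exact h1
  refine ⟨h, key X _ (Ring.inverse_mul_cancel X hX) hi,
    key (star X) (star (Ring.inverse X)) ?_ (by rwa [norm_star])⟩
  rw [← star_mul, Ring.mul_inverse_cancel X hX, star_one]

end Annulus

end Functional

/-! ### Lipschitz estimates in the ideal for `φ(|X|)` -/

section AbsLipschitz

variable {H : Type*} [NormedAddCommGroup H] [InnerProductSpace ℂ H] [CompleteSpace H]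

open NormedIdeal NormedIdeal.Space

/-- `X ↦ φ(|X|)` is `J`-Lipschitz on the operators with `a ≤ |X|, |X*| ≤ b`. -/
def NormedIdeal.AbsLipschitzOn (J : NormedIdeal H) (φ : ℝ → ℝ) (a b : ℝ) : Prop :=
  ∃ C : ℝ, 0 ≤ C ∧ ∀ X Y : H →L[ℂ] H, Annulus a b X → Annulus a b Y → ∀ Z : J.Space,
    Z.val = X - Y → ∃ W : J.Space, W.val = cfc φ (CFC.abs X) - cfc φ (CFC.abs Y) ∧ ‖W‖ ≤ C * ‖Z‖

theorem NormedIdeal.LipschitzFunctionOn.exists_val_eq {J : NormedIdeal H} {f : ℝ → ℝ} {a b : ℝ}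
    (h : J.LipschitzFunctionOn f a b) : ∃ C : ℝ, 0 ≤ C ∧ ∀ A ∈ selfAdjointIcc H a b,
      ∀ B ∈ selfAdjointIcc H a b, ∀ Z : J.Space, Z.val = A - B →
        ∃ W : J.Space, W.val = cfc f A - cfc f B ∧ ‖W‖ ≤ C * ‖Z‖ := by
  obtain ⟨-, C, hC, h⟩ := h
  refine ⟨C, hC.le, fun A hA B hB Z hZ => ?_⟩
  have hm : A - B ∈ J.toSubmodule := hZ ▸ Z.val_mem
  obtain ⟨h', hn⟩ := h A hA B hB hm
  refine ⟨Space.mk _ h', rfl, ?_⟩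
  have hZ' : Z = Space.mk _ hm := val_injective hZ
  rw [hZ']
  exact hn

theorem norm_sub_algebraMap_le {A : H →L[ℂ] H} {a b : ℝ} (hab : a ≤ b)
    (hA : A ∈ selfAdjointIcc H a b) :
    ‖A - algebraMap ℝ (H →L[ℂ] H) ((a + b) / 2)‖ ≤ (b - a) / 2 := by
  have e : A - algebraMap ℝ (H →L[ℂ] H) ((a + b) / 2) = cfc (fun x : ℝ => x - (a + b) / 2) A := by
    rw [cfc_sub (fun x : ℝ => x) (fun _ => (a + b) / 2) A, cfc_id' ℝ A hA.1, cfc_const _ A hA.1]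
  rw [e]
  refine norm_cfc_le (by linarith) fun x hx => ?_
  have := hA.2 hx
  rw [Real.norm_eq_abs, abs_le]
  constructor <;> linarith [this.1, this.2]

/-- `X*X - Y*Y = X*(X - Y) + (X - Y)*Y`. -/
theorem exists_val_eq_star_mul_self_sub {J : NormedIdeal H} {b : ℝ} {X Y : H →L[ℂ] H}
    (hX : ‖X‖ ≤ b) (hY : ‖Y‖ ≤ b) (Z : J.Space) (hZ : Z.val = X - Y) :
    ∃ S : J.Space, S.val = star X * X - star Y * Y ∧ ‖S‖ ≤ 2 * b * ‖Z‖ := by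
  refine ⟨lmul (star X) Z + rmul (adj Z) Y, ?_, ?_⟩
  · rw [val_add, val_lmul, val_rmul, val_adj, hZ, star_sub]
    noncomm_ring
  · have h1 : ‖lmul (star X) Z‖ ≤ b * ‖Z‖ :=
      (norm_lmul_le _ _).trans (by rw [norm_star]; gcongr)
    have h2 : ‖rmul (adj Z) Y‖ ≤ ‖Z‖ * b :=
      (norm_rmul_le _ _).trans (by gcongr; exact norm_adj_le Z)
    linarith [norm_add_le (lmul (star X) Z) (rmul (adj Z) Y)]

/-- The Sylvester equation `W P + Q W = S` is solvable in the ideal for `P, Q ≥ a > 0`. -/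
theorem exists_sylvester {J : NormedIdeal H} {a b : ℝ} (ha : 0 < a) (hab : a ≤ b)
    {P Q : H →L[ℂ] H} (hP : P ∈ selfAdjointIcc H a b) (hQ : Q ∈ selfAdjointIcc H a b)
    (S : J.Space) :
    ∃ W : J.Space, W.val * P + Q * W.val = S.val ∧ 2 * a * ‖W‖ ≤ ‖S‖ := by
  -- Centring `P` and `Q` at the midpoint `m` leaves remainders of norm at most `r`. The equation
  -- becomes `2 m W = S - (W P' + Q' W)`, a contraction of ratio `r / m`, which is below `1` because
  -- `a > 0`.
  set m : ℝ := (a + b) / 2 with hm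
  set r : ℝ := (b - a) / 2 with hr
  have hm0 : 0 < m := by simp only [hm]; linarith
  have hr0 : 0 ≤ r := by simp only [hr]; linarith
  set P' := P - algebraMap ℝ (H →L[ℂ] H) m with hP'
  set Q' := Q - algebraMap ℝ (H →L[ℂ] H) m with hQ'
  have hPn : ‖P'‖ ≤ r := norm_sub_algebraMap_le hab hP
  have hQn : ‖Q'‖ ≤ r := norm_sub_algebraMap_le hab hQ
  let L : J.Space → J.Space := fun D => rmul D P' + lmul Q' D
  have hL : ∀ D, ‖L D‖ ≤ 2 * r * ‖D‖ := fun D => by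
    have h1 : ‖rmul D P'‖ ≤ ‖D‖ * r := (norm_rmul_le _ _).trans (by gcongr)
    have h2 : ‖lmul Q' D‖ ≤ r * ‖D‖ := (norm_lmul_le _ _).trans (by gcongr)
    linarith [norm_add_le (rmul D P') (lmul Q' D)]
  have hLs : ∀ D E, L D - L E = L (D - E) := fun D E => val_injective <| by
    simp only [L, val_add, val_sub, val_rmul, val_lmul]
    noncomm_ring
  let Φ : J.Space → J.Space := fun D => (((2 * m)⁻¹ : ℝ) : ℂ) • (S - L D)
  have hq : r / m < 1 := by
    rw [div_lt_one hm0]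
    simp only [hr, hm]
    linarith
  have hΦ : ContractingWith (Real.toNNReal (r / m)) Φ := by
    refine ⟨by rwa [Real.toNNReal_lt_one], LipschitzWith.of_dist_le_mul fun D E => ?_⟩
    rw [dist_eq_norm, dist_eq_norm, ← smul_sub, sub_sub_sub_cancel_left, hLs, norm_smul,
      Complex.norm_real, Real.norm_of_nonneg (by positivity)]
    refine (mul_le_mul_of_nonneg_left (hL _) (by positivity)).trans (le_of_eq ?_)
    rw [norm_sub_rev]
    rw [Real.coe_toNNReal _ (by positivity)]
    field_simp
  let W := hΦ.fixedPoint Φ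
  have hW : Φ W = W := hΦ.fixedPoint_isFixedPt
  have hW2 : ((2 * m : ℝ) : ℂ) • W = S - L W := by
    conv_lhs => rw [← hW]
    simp only [Φ]
    rw [smul_smul, ← Complex.ofReal_mul, mul_inv_cancel₀ (by positivity), Complex.ofReal_one,
      one_smul]
  refine ⟨W, ?_, ?_⟩
  · have h1 : ((2 * m : ℝ) : ℂ) • W.val = S.val - (W.val * P' + Q' * W.val) := by
      have := congrArg val hW2
      simpa only [val_smul, val_sub, val_add, val_rmul, val_lmul, L] using this
    rw [hP', hQ', mul_sub, sub_mul, ← Algebra.commutes, ← Algebra.smul_def, Complex.coe_smul,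
      two_mul, add_smul] at h1
    rw [← sub_eq_zero] at h1 ⊢
    rw [← h1]
    abel
  · have h1 : ‖((2 * m : ℝ) : ℂ) • W‖ ≤ ‖S‖ + 2 * r * ‖W‖ := by
      rw [hW2]
      exact (norm_sub_le _ _).trans (by gcongr; exact hL W)
    rw [norm_smul, Complex.norm_real, Real.norm_of_nonneg (by positivity)] at h1
    have : 2 * m - 2 * r = 2 * a := by simp only [hm, hr]; ring
    calc 2 * a * ‖W‖ = 2 * m * ‖W‖ - 2 * r * ‖W‖ := by rw [← this]; ring
      _ ≤ ‖S‖ := by linarith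

/-- The same centring in the operator norm. It is needed because `|X| - |Y|` is not known in advance
to lie in the ideal, so uniqueness must hold among bounded operators. -/
theorem sylvester_eq_zero {a b : ℝ} (ha : 0 < a) (hab : a ≤ b) {P Q E : H →L[ℂ] H}
    (hP : P ∈ selfAdjointIcc H a b) (hQ : Q ∈ selfAdjointIcc H a b) (hE : E * P + Q * E = 0) :
    E = 0 := by
  set m : ℝ := (a + b) / 2 with hm
  set r : ℝ := (b - a) / 2 with hr
  set P' := P - algebraMap ℝ (H →L[ℂ] H) m with hP'
  set Q' := Q - algebraMap ℝ (H →L[ℂ] H) m with hQ'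
  have hPn : ‖P'‖ ≤ r := norm_sub_algebraMap_le hab hP
  have hQn : ‖Q'‖ ≤ r := norm_sub_algebraMap_le hab hQ
  have h1 : (2 * m) • E = -(E * P' + Q' * E) := by
    rw [hP', hQ', mul_sub, sub_mul, ← Algebra.commutes, ← Algebra.smul_def, two_mul, add_smul,
      ← sub_eq_zero, ← hE]
    abel
  have h2 : ‖(2 * m) • E‖ ≤ 2 * r * ‖E‖ := by
    have h3 : ‖E * P'‖ ≤ ‖E‖ * r := (norm_mul_le _ _).trans (by gcongr)
    have h4 : ‖Q' * E‖ ≤ r * ‖E‖ := (norm_mul_le _ _).trans (by gcongr)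
    rw [h1, norm_neg]
    linarith [norm_add_le (E * P') (Q' * E)]
  rw [norm_smul, Real.norm_of_nonneg (by simp only [hm]; linarith)] at h2
  have h5 : 2 * m - 2 * r = 2 * a := by simp only [hm, hr]; ring
  rw [← norm_le_zero_iff]
  have := norm_nonneg E
  nlinarith

/-- `D = |X| - |Y|` satisfies `D|X| + |Y|D = X*X - Y*Y`. Hence `D` is the ideal solution, and `2a‖D‖
≤ 2b‖X - Y‖` in the ideal norm, which explains the factor `b / a`. -/
theorem NormedIdeal.LipschitzFunctionOn.absLipschitzOn_of_pos {J : NormedIdeal H} {f : ℝ → ℝ}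
    {a b : ℝ} (ha : 0 < a) (hab : a ≤ b) (h : J.LipschitzFunctionOn f a b) :
    J.AbsLipschitzOn f a b := by
  obtain ⟨C, hC, h⟩ := h.exists_val_eq
  have hb : 0 < b := ha.trans_le hab
  refine ⟨C * (b / a), by positivity, fun X Y hX hY Z hZ => ?_⟩
  have hX' := hX.cfcAbs_mem ha.le
  have hY' := hY.cfcAbs_mem ha.le
  obtain ⟨S, hS, hSn⟩ := exists_val_eq_star_mul_self_sub hX.norm_le hY.norm_le Z hZ
  obtain ⟨D, hD, hDn⟩ := exists_sylvester ha hab hX' hY' S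
  have hE : D.val - (CFC.abs X - CFC.abs Y) = 0 := by
    refine sylvester_eq_zero ha hab hX' hY' ?_
    have h1 : (CFC.abs X - CFC.abs Y) * CFC.abs X + CFC.abs Y * (CFC.abs X - CFC.abs Y) =
        star X * X - star Y * Y := by
      rw [← CFC.abs_mul_abs, ← CFC.abs_mul_abs]
      noncomm_ring
    rw [sub_mul, mul_sub, ← sub_eq_zero.2 (hD.trans (hS.trans h1.symm))]
    abel
  obtain ⟨W, hW, hWn⟩ := h _ hX' _ hY' D (sub_eq_zero.1 hE)
  refine ⟨W, hW, hWn.trans ?_⟩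
  rw [mul_assoc]
  gcongr
  rw [div_mul_eq_mul_div, le_div_iff₀ ha]
  linarith

theorem OrthogonalFamily.inner_linearIsometry_eq_zero {ι : Type*} {v₁ v₂ : ι → ℂ →ₗᵢ[ℂ] H}
    (h₁ : OrthogonalFamily ℂ (fun _ => ℂ) v₁) (h₂ : OrthogonalFamily ℂ (fun _ => ℂ) v₂)
    (h : ∀ i j x y, inner ℂ (v₁ i x) (v₂ j y) = 0) (x y : lp (fun _ : ι => ℂ) 2) :
    inner ℂ (h₁.linearIsometry x) (h₂.linearIsometry y) = 0 := by
  have key : ∀ j z, inner ℂ (v₂ j z) (h₁.linearIsometry x) = 0 := fun j z => by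
    have := (h₁.hasSum_linearIsometry x).mapL (innerSL ℂ (v₂ j z))
    refine this.unique ?_
    have h0 : ∀ i, innerSL ℂ (v₂ j z) (v₁ i (x i)) = 0 := fun i =>
      inner_eq_zero_symm.1 (h i j _ _)
    simp only [h0]
    exact hasSum_zero
  have := (h₂.hasSum_linearIsometry y).mapL (innerSL ℂ (h₁.linearIsometry x))
  refine this.unique ?_
  have h0 : ∀ j, innerSL ℂ (h₁.linearIsometry x) (v₂ j (y j)) = 0 := fun j =>
    inner_eq_zero_symm.1 (key j _)
  simp only [h0]
  exact hasSum_zero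

/-- An infinite-dimensional Hilbert space carries two isometries with orthogonal ranges. -/
theorem exists_isometries (hH : ¬ FiniteDimensional ℂ H) : ∃ V₁ V₂ : H →L[ℂ] H,
    star V₁ * V₁ = 1 ∧ star V₂ * V₂ = 1 ∧ star V₁ * V₂ = 0 ∧ star V₂ * V₁ = 0 := by
  obtain ⟨w, e, -⟩ := exists_hilbertBasis ℂ H
  have hw : Infinite w := by
    refine not_finite_iff_infinite.1 fun hfin => hH ?_
    have := Fintype.ofFinite w
    exact e.toOrthonormalBasis.toBasis.finiteDimensional_of_finite
  -- An infinite basis splits into two parts, each in bijection with the whole.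
  obtain ⟨σ⟩ : Nonempty (w ⊕ w ≃ w) := Cardinal.eq.1 (by
    rw [Cardinal.mk_sum, Cardinal.lift_id, Cardinal.add_eq_self (Cardinal.aleph0_le_mk w)])
  have o₁ : Orthonormal ℂ fun i => e (σ (.inl i)) :=
    e.orthonormal.comp _ (σ.injective.comp Sum.inl_injective)
  have o₂ : Orthonormal ℂ fun i => e (σ (.inr i)) :=
    e.orthonormal.comp _ (σ.injective.comp Sum.inr_injective)
  let U₁ : H →ₗᵢ[ℂ] H := o₁.orthogonalFamily.linearIsometry.comp e.repr.toLinearIsometry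
  let U₂ : H →ₗᵢ[ℂ] H := o₂.orthogonalFamily.linearIsometry.comp e.repr.toLinearIsometry
  have h12 : ∀ x y, inner ℂ (U₁ x) (U₂ y) = 0 := fun x y => by
    refine OrthogonalFamily.inner_linearIsometry_eq_zero o₁.orthogonalFamily
      o₂.orthogonalFamily (fun i j x y => ?_) (e.repr x) (e.repr y)
    have : inner ℂ (e (σ (.inl i))) (e (σ (.inr j))) = 0 :=
      e.orthonormal.2 (fun h => Sum.inl_ne_inr (σ.injective h))
    simp [this]
  have key : ∀ (U W : H →ₗᵢ[ℂ] H) (S : H →L[ℂ] H),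
      (∀ x y, inner ℂ (U x) (W y) = inner ℂ x (S y)) →
      star U.toContinuousLinearMap * W.toContinuousLinearMap = S := fun U W S h => by
    ext y
    refine ext_inner_left ℂ fun x => ?_
    rw [mul_apply_eq_comp, ContinuousLinearMap.star_eq_adjoint,
      ContinuousLinearMap.adjoint_inner_right]
    exact h x y
  refine ⟨U₁.toContinuousLinearMap, U₂.toContinuousLinearMap, key _ _ _ fun x y => ?_,
    key _ _ _ fun x y => ?_, key _ _ _ fun x y => ?_, key _ _ _ fun x y => ?_⟩
  · exact U₁.inner_map_map x y
  · exact U₂.inner_map_map x y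
  · simpa using h12 x y
  · simpa using inner_eq_zero_symm.1 (h12 y x)

/-- The norm of an isometry is at most one. -/
theorem norm_le_one_of_star_mul_self {V : H →L[ℂ] H} (h : star V * V = 1) : ‖V‖ ≤ 1 := by
  have h1 : ‖star V * V‖ = ‖V‖ * ‖V‖ := CStarRing.norm_star_mul_self
  rw [h] at h1
  have h2 : ‖(1 : H →L[ℂ] H)‖ ≤ 1 := ContinuousLinearMap.norm_id_le
  nlinarith [norm_nonneg V]

section Dilation

variable {V₁ V₂ : H →L[ℂ] H}

/-- The self-adjoint dilation of an operator, the matrix with rows `0, X*` and `X, 0`. -/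
def dilation (V₁ V₂ X : H →L[ℂ] H) : H →L[ℂ] H := V₁ * star X * star V₂ + V₂ * X * star V₁

theorem isSelfAdjoint_dilation (X : H →L[ℂ] H) : IsSelfAdjoint (dilation V₁ V₂ X) := by
  rw [isSelfAdjoint_iff, dilation, star_add, star_mul, star_mul, star_mul, star_mul, star_star,
    star_star, star_star, add_comm, mul_assoc, mul_assoc]

theorem dilation_mul_fst (h₁ : star V₁ * V₁ = 1) (h₂₁ : star V₂ * V₁ = 0) (X : H →L[ℂ] H) :
    dilation V₁ V₂ X * V₁ = V₂ * X := by
  rw [dilation, add_mul, mul_assoc, h₂₁, mul_assoc (V₂ * X), h₁, mul_zero, mul_one, zero_add]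

theorem dilation_mul_snd (h₂ : star V₂ * V₂ = 1) (h₁₂ : star V₁ * V₂ = 0) (X : H →L[ℂ] H) :
    dilation V₁ V₂ X * V₂ = V₁ * star X := by
  rw [dilation, add_mul, mul_assoc, h₂, mul_assoc (V₂ * X), h₁₂, mul_zero, mul_one, add_zero]

theorem norm_add_apply_sq_le (h₁ : star V₁ * V₁ = 1) (h₂ : star V₂ * V₂ = 1)
    (h₁₂ : star V₁ * V₂ = 0) (u w : H) : ‖V₁ u + V₂ w‖ ^ 2 ≤ ‖u‖ ^ 2 + ‖w‖ ^ 2 := by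
  have n₁ : ‖V₁ u‖ ≤ ‖u‖ := by
    simpa using V₁.le_of_opNorm_le (norm_le_one_of_star_mul_self h₁) u
  have n₂ : ‖V₂ w‖ ≤ ‖w‖ := by
    simpa using V₂.le_of_opNorm_le (norm_le_one_of_star_mul_self h₂) w
  have h0 : inner ℂ (V₁ u) (V₂ w) = 0 := by
    rw [← ContinuousLinearMap.adjoint_inner_right, ← ContinuousLinearMap.star_eq_adjoint,
      ← mul_apply_eq_comp, h₁₂, zero_apply, inner_zero_right]
  rw [norm_add_sq (𝕜 := ℂ), h0, map_zero, mul_zero, add_zero]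
  gcongr

theorem norm_dilation_le (h₁ : star V₁ * V₁ = 1) (h₂ : star V₂ * V₂ = 1)
    (h₁₂ : star V₁ * V₂ = 0) (X : H →L[ℂ] H) : ‖dilation V₁ V₂ X‖ ≤ ‖X‖ := by
  refine ContinuousLinearMap.opNorm_le_bound _ (norm_nonneg _) fun v => ?_
  set u := star V₁ v with hu
  set w := star V₂ v with hw
  -- Bessel's inequality for the two orthogonal ranges, obtained by pairing `V₁ u + V₂ w` with `v`.
  have bessel : ‖u‖ ^ 2 + ‖w‖ ^ 2 ≤ ‖v‖ ^ 2 := by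
    have e1 : inner ℂ (V₁ u + V₂ w) v = ((‖u‖ ^ 2 + ‖w‖ ^ 2 : ℝ) : ℂ) := by
      rw [inner_add_left, ← ContinuousLinearMap.adjoint_inner_right V₁,
        ← ContinuousLinearMap.adjoint_inner_right V₂, ← ContinuousLinearMap.star_eq_adjoint,
        ← ContinuousLinearMap.star_eq_adjoint, ← hu, ← hw, inner_self_eq_norm_sq_to_K,
        inner_self_eq_norm_sq_to_K]
      push_cast
      rfl
    have e2 : ‖u‖ ^ 2 + ‖w‖ ^ 2 ≤ ‖V₁ u + V₂ w‖ * ‖v‖ := by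
      have := re_inner_le_norm (𝕜 := ℂ) (V₁ u + V₂ w) v
      rw [e1] at this
      simpa only [RCLike.re_eq_complex_re, Complex.ofReal_re] using this
    have e3 := norm_add_apply_sq_le h₁ h₂ h₁₂ u w
    nlinarith [sq_nonneg (‖V₁ u + V₂ w‖ - ‖v‖)]
  have e4 : dilation V₁ V₂ X v = V₁ (star X w) + V₂ (X u) := rfl
  have e5 := norm_add_apply_sq_le h₁ h₂ h₁₂ (star X w) (X u)
  have e6 : ‖star X w‖ ^ 2 ≤ (‖X‖ * ‖w‖) ^ 2 := by
    gcongr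
    rw [← norm_star X]
    exact (star X).le_opNorm w
  have e7 : ‖X u‖ ^ 2 ≤ (‖X‖ * ‖u‖) ^ 2 := by
    gcongr
    exact X.le_opNorm u
  rw [e4]
  refine (pow_le_pow_iff_left₀ (norm_nonneg _) (by positivity) two_ne_zero).1 ?_
  calc ‖V₁ (star X w) + V₂ (X u)‖ ^ 2 ≤ ‖X‖ ^ 2 * (‖u‖ ^ 2 + ‖w‖ ^ 2) := by nlinarith
    _ ≤ (‖X‖ * ‖v‖) ^ 2 := by
      rw [mul_pow]
      gcongr

theorem star_mul_self_mem_selfAdjointIcc {b : ℝ} {X : H →L[ℂ] H} (hX : ‖X‖ ≤ b) :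
    star X * X ∈ selfAdjointIcc H 0 (b ^ 2) := by
  refine ⟨.star_mul_self X, fun x hx => ⟨spectrum_nonneg_of_nonneg (star_mul_self_nonneg X) hx, ?_⟩⟩
  have h1 := spectrum.norm_le_norm_mul_of_mem hx
  rw [CStarRing.norm_star_mul_self] at h1
  have h2 : ‖X‖ * ‖X‖ * ‖(1 : H →L[ℂ] H)‖ ≤ ‖X‖ * ‖X‖ :=
    mul_le_of_le_one_right (by positivity) ContinuousLinearMap.norm_id_le
  have h3 := norm_nonneg X
  refine (le_abs_self x).trans (h1.trans (h2.trans ?_))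
  nlinarith

theorem continuousOn_comp_sqrt {b : ℝ} (hb : 0 ≤ b) {φ : ℝ → ℝ} (hφ : ContinuousOn φ (Icc 0 b)) :
    ContinuousOn (fun x => φ (√x)) (Icc 0 (b ^ 2)) := by
  refine hφ.comp Real.continuous_sqrt.continuousOn fun x hx => ⟨Real.sqrt_nonneg x, ?_⟩
  exact (Real.sqrt_le_sqrt hx.2).trans_eq (Real.sqrt_sq hb)

/-- An even function of the dilation `A` is a function of `A²`, and `A² V₁ = V₁ X*X`. Thus `V₁`
intertwines functions of `A²` with those of `X*X`. -/
theorem cfc_even_dilation_mul (h₁ : star V₁ * V₁ = 1) (h₂ : star V₂ * V₂ = 1)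
    (h₁₂ : star V₁ * V₂ = 0) (h₂₁ : star V₂ * V₁ = 0) {b : ℝ} {φ : ℝ → ℝ}
    (hφ : ContinuousOn φ (Icc 0 b)) {X : H →L[ℂ] H} (hX : ‖X‖ ≤ b) :
    cfc (fun x => φ |x|) (dilation V₁ V₂ X) * V₁ = V₁ * cfc φ (CFC.abs X) := by
  set A := dilation V₁ V₂ X with hA
  have hAsa : IsSelfAdjoint A := isSelfAdjoint_dilation X
  have hAn : ‖A‖ ≤ b := (norm_dilation_le h₁ h₂ h₁₂ X).trans hX
  have cont : ∀ Y : H →L[ℂ] H, ‖Y‖ ≤ b → ContinuousOn φ (spectrum ℝ (CFC.abs Y)) := fun Y hY =>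
    hφ.mono ((Annulus.of_nonpos le_rfl hY).spectrum_cfcAbs_subset le_rfl)
  have e1 : cfc (fun x => φ |x|) A = cfc φ (CFC.abs A) := by
    have hc := cont A hAn
    have e0 : CFC.abs A = cfc (fun x : ℝ => |x|) A := CFC.abs_eq_cfc_norm A hAsa
    rw [e0] at hc ⊢
    rw [cfc_map_spectrum (R := ℝ) (hf := continuous_abs.continuousOn) (ha := hAsa)] at hc
    exact cfc_comp φ (fun x : ℝ => |x|) A hAsa hc continuous_abs.continuousOn
  rw [e1, cfc_cfcAbs_eq (cont A hAn), cfc_cfcAbs_eq (cont X hX)]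
  refine cfc_mul_eq_mul_cfc ?_ (continuousOn_comp_sqrt ((norm_nonneg X).trans hX) hφ)
    (star_mul_self_mem_selfAdjointIcc hAn) (star_mul_self_mem_selfAdjointIcc hX)
  rw [hAsa.star_eq, mul_assoc, hA, dilation_mul_fst h₁ h₂₁, ← mul_assoc,
    dilation_mul_snd h₂ h₁₂, mul_assoc]

end Dilation

/-- Dilate, apply the self-adjoint hypothesis on `[-b, b]`, and compress by `V₁`. The factor `2`
comes from the two off-diagonal entries of the dilated difference. -/
theorem NormedIdeal.LipschitzFunctionOn.absLipschitzOn_zero (hH : ¬ FiniteDimensional ℂ H)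
    {J : NormedIdeal H} {φ : ℝ → ℝ} {b : ℝ} (hφ : ContinuousOn φ (Icc 0 b))
    (h : J.LipschitzFunctionOn (fun x => φ |x|) (-b) b) : J.AbsLipschitzOn φ 0 b := by
  obtain ⟨V₁, V₂, h₁, h₂, h₁₂, h₂₁⟩ := exists_isometries hH
  obtain ⟨C, hC, h⟩ := h.exists_val_eq
  have n₁ := norm_le_one_of_star_mul_self h₁
  have n₂ := norm_le_one_of_star_mul_self h₂
  have m₁ : ‖star V₁‖ ≤ 1 := by rwa [norm_star]
  have m₂ : ‖star V₂‖ ≤ 1 := by rwa [norm_star]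
  have hs : ∀ (Y W : H →L[ℂ] H) (Z : J.Space), ‖Y‖ ≤ 1 → ‖W‖ ≤ 1 → ‖sandwich Y Z W‖ ≤ ‖Z‖ :=
    fun Y W Z hY hW => (norm_sandwich_le Y Z W).trans
      ((mul_le_of_le_one_right (by positivity) hW).trans
        (mul_le_of_le_one_left (norm_nonneg _) hY))
  have mem : ∀ X : H →L[ℂ] H, ‖X‖ ≤ b → dilation V₁ V₂ X ∈ selfAdjointIcc H (-b) b := by
    refine fun X hX => ⟨isSelfAdjoint_dilation X, fun x hx => abs_le.1 ?_⟩
    have k1 := spectrum.norm_le_norm_mul_of_mem hx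
    have k2 : ‖dilation V₁ V₂ X‖ * ‖(1 : H →L[ℂ] H)‖ ≤ ‖dilation V₁ V₂ X‖ :=
      mul_le_of_le_one_right (norm_nonneg _) ContinuousLinearMap.norm_id_le
    exact k1.trans (k2.trans ((norm_dilation_le h₁ h₂ h₁₂ X).trans hX))
  refine ⟨C * 2, by positivity, fun X Y hX hY Z hZ => ?_⟩
  obtain ⟨W, hW, hWn⟩ := h _ (mem X hX.norm_le) _ (mem Y hY.norm_le)
    (sandwich V₁ (adj Z) (star V₂) + sandwich V₂ Z (star V₁)) (by
      rw [val_add, val_sandwich, val_sandwich, val_adj, hZ, star_sub, dilation, dilation]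
      noncomm_ring)
  refine ⟨sandwich (star V₁) W V₁, ?_, ?_⟩
  · rw [val_sandwich, hW, mul_assoc, sub_mul, cfc_even_dilation_mul h₁ h₂ h₁₂ h₂₁ hφ hX.norm_le,
      cfc_even_dilation_mul h₁ h₂ h₁₂ h₂₁ hφ hY.norm_le, mul_sub, ← mul_assoc, ← mul_assoc, h₁,
      one_mul, one_mul]
  · refine (hs _ _ _ m₁ n₁).trans (hWn.trans ?_)
    rw [mul_assoc]
    gcongr
    refine (norm_add_le _ _).trans ?_
    linarith [(hs V₁ (star V₂) (adj Z) n₁ m₂).trans (norm_adj_le Z), hs V₂ (star V₁) Z n₂ m₁]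

end AbsLipschitz

/-! ### First-order decay of the norm along the flow -/

section Decay

variable {H : Type*} [NormedAddCommGroup H] [InnerProductSpace ℂ H] [CompleteSpace H]

open Filter

/-- Square root of the identity `(XX*)X = X(X*X)`. -/
theorem cfcAbs_star_mul (X : H →L[ℂ] H) : CFC.abs (star X) * X = X * CFC.abs X := by
  rw [cfcAbs_eq_cfc_sqrt, cfcAbs_eq_cfc_sqrt]
  refine cfc_mul_eq_mul_cfc (c := 0) (d := ‖X‖ ^ 2) (by rw [star_star, mul_assoc])
    Real.continuous_sqrt.continuousOn (star_mul_self_mem_selfAdjointIcc (norm_star X).le)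
    (star_mul_self_mem_selfAdjointIcc le_rfl)

theorem cfc_cfcAbs_star_mul {a b : ℝ} (ha : 0 ≤ a) {X : H →L[ℂ] H} (hX : Annulus a b X)
    {f : ℝ → ℝ} (hf : ContinuousOn f (Icc a b)) :
    cfc f (CFC.abs (star X)) * X = X * cfc f (CFC.abs X) :=
  cfc_mul_eq_mul_cfc (cfcAbs_star_mul X) hf (hX.star.cfcAbs_mem ha) (hX.cfcAbs_mem ha)

theorem norm_mul_eq_norm_cfcAbs_star_mul {G : H →L[ℂ] H} (hG : IsSelfAdjoint G) (W : H →L[ℂ] H) :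
    ‖G * W‖ = ‖CFC.abs (star W) * G‖ := by
  rw [← norm_star, star_mul, hG.star_eq]
  have h : ∀ v, ‖(CFC.abs (star W) * G) v‖ = ‖(star W * G) v‖ := fun v =>
    norm_cfcAbs_apply (star W) (G v)
  refine le_antisymm ?_ ?_
  · exact ContinuousLinearMap.opNorm_le_bound _ (norm_nonneg _) fun v =>
      (h v).symm.trans_le (ContinuousLinearMap.le_opNorm _ v)
  · exact ContinuousLinearMap.opNorm_le_bound _ (norm_nonneg _) fun v =>
      (h v).trans_le (ContinuousLinearMap.le_opNorm _ v)

/-- Taking adjoints replaces the right factor `W` by `|W*|`, so that only the scalar function `x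
g(x)` is left to bound. -/
theorem norm_cfc_cfcAbs_star_mul_le {a s c : ℝ} (ha : 0 ≤ a) {W : H →L[ℂ] H}
    (hW : Annulus a s W) {g : ℝ → ℝ} (hg : ContinuousOn g (Icc a s)) (hc : 0 ≤ c)
    (h : ∀ x ∈ Icc a s, |x * g x| ≤ c) : ‖cfc g (CFC.abs (star W)) * W‖ ≤ c := by
  have hm := hW.star.cfcAbs_mem ha
  rw [norm_mul_eq_norm_cfcAbs_star_mul (cfc_predicate g _)]
  have e : CFC.abs (star W) * cfc g (CFC.abs (star W)) =
      cfc (fun x => x * g x) (CFC.abs (star W)) := by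
    rw [cfc_mul (fun x => x) g _ continuousOn_id (hg.mono hm.2), cfc_id' ℝ _ hm.1]
  rw [e]
  exact norm_cfc_le hc fun x hx => h x (hm.2 hx)

/-- Near `s` the factor `β` is small by continuity; at distance at least `η` from `s` the slack `η`
absorbs the increment, of size at most `h s M`. -/
theorem eventually_mul_one_add_le {a s : ℝ} (ha : 0 ≤ a) (has : a ≤ s) {β : ℝ → ℝ}
    (hβ : ContinuousOn β (Icc a s)) (hβ0 : ∀ x ∈ Icc a s, 0 ≤ β x) (hβs : β s = 0) {ε : ℝ}
    (hε : 0 < ε) :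
    ∀ᶠ h in 𝓝[>] (0 : ℝ), ∀ x ∈ Icc a s, |x * (1 + h * β x)| ≤ s + ε * h := by
  have hs : 0 ≤ s := ha.trans has
  obtain ⟨M, hM⟩ := (isCompact_Icc.image_of_continuousOn hβ).bddAbove
  have hM' : ∀ x ∈ Icc a s, β x ≤ M := fun x hx => hM ⟨x, hx, rfl⟩
  have hM0 : 0 ≤ M := by
    have := hM' s ⟨has, le_rfl⟩
    rwa [hβs] at this
  obtain ⟨η, hη, hηβ⟩ := Metric.continuousOn_iff.1 hβ s ⟨has, le_rfl⟩ (ε / (s + 1)) (by positivity)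
  have h1 : ∀ᶠ h in 𝓝[>] (0 : ℝ), h < η / (s * M + 1) :=
    nhdsWithin_le_nhds (eventually_lt_nhds (by positivity))
  filter_upwards [h1, self_mem_nhdsWithin] with h hh hpos x hx
  have hpos : 0 < h := hpos
  have hx0 : 0 ≤ x := ha.trans hx.1
  have hb0 := hβ0 x hx
  rw [abs_of_nonneg (by positivity)]
  by_cases hxs : s - x < η
  · have h2 := hηβ x hx (by
      rw [Real.dist_eq, abs_sub_comm, abs_of_nonneg (by linarith [hx.2])]
      exact hxs)
    rw [hβs, Real.dist_eq, sub_zero, abs_of_nonneg hb0, lt_div_iff₀ (by positivity)] at h2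
    have h3 : x * β x ≤ ε := by nlinarith [hx.2]
    nlinarith [hx.2]
  · rw [lt_div_iff₀ (by positivity)] at hh
    have h3 : x * β x ≤ s * M := mul_le_mul hx.2 (hM' x hx) hb0 hs
    have h4 : h * (x * β x) ≤ h * (s * M) := by gcongr
    nlinarith

/-- First order decay of the norm along the direction `[χ₁(|W|) - χ₂(|W*|), W]`. -/
theorem eventually_norm_add_smul_lie_le {a s : ℝ} (ha : 0 ≤ a) (has : a ≤ s) {W : H →L[ℂ] H}
    (hW : Annulus a s W) {χ₁ χ₂ : ℝ → ℝ} (c₁ : ContinuousOn χ₁ (Icc a s))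
    (c₂ : ContinuousOn χ₂ (Icc a s)) (m₁ : MonotoneOn χ₁ (Icc a s))
    (m₂ : MonotoneOn χ₂ (Icc a s)) {ε : ℝ} (hε : 0 < ε) :
    ∀ᶠ h in 𝓝[>] (0 : ℝ), ‖W + h • ⁅opPhi χ₁ χ₂ W, W⁆‖ ≤ s + ε * h := by
  have hs : 0 ≤ s := ha.trans has
  have hmem := hW.cfcAbs_mem ha
  have hmem' := hW.star.cfcAbs_mem ha
  have ss : s ∈ Icc a s := ⟨has, le_rfl⟩
  set Q₁ := cfc χ₁ (CFC.abs W) with hQ₁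
  set Q₁' := cfc χ₁ (CFC.abs (star W)) with hQ₁'
  set Q₂ := cfc χ₂ (CFC.abs (star W)) with hQ₂
  have hint : Q₁' * W = W * Q₁ := cfc_cfcAbs_star_mul ha hW c₁
  -- By monotonicity, `1 - h(χ(s) - χ(x))` takes values in `[0, 1]` for small `h`.
  have contr : ∀ (χ : ℝ → ℝ) (A : H →L[ℂ] H), ContinuousOn χ (Icc a s) → MonotoneOn χ (Icc a s) →
      A ∈ selfAdjointIcc H a s →
      ∀ᶠ h in 𝓝[>] (0 : ℝ), ‖1 - h • (algebraMap ℝ (H →L[ℂ] H) (χ s) - cfc χ A)‖ ≤ 1 := by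
    intro χ A hc hm hA
    have h1 : ∀ᶠ h in 𝓝[>] (0 : ℝ), h < 1 / (χ s - χ a + 1) := by
      refine nhdsWithin_le_nhds (eventually_lt_nhds ?_)
      have := hm ⟨le_rfl, has⟩ ss has
      exact div_pos one_pos (by linarith)
    filter_upwards [h1, self_mem_nhdsWithin] with h hh hpos
    have hpos : 0 < h := hpos
    have hcA := hc.mono hA.2
    have e : 1 - h • (algebraMap ℝ (H →L[ℂ] H) (χ s) - cfc χ A) =
        cfc (fun x => 1 - h * (χ s - χ x)) A := by
      rw [cfc_sub (fun _ => (1 : ℝ)) (fun x => h * (χ s - χ x)) A (by fun_prop) (by fun_prop),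
        cfc_const_one ℝ A hA.1, cfc_const_mul h (fun x => χ s - χ x) A (by fun_prop),
        cfc_sub (fun _ => χ s) χ A (by fun_prop) hcA, cfc_const _ A hA.1]
    rw [e]
    refine norm_cfc_le zero_le_one fun x hx => ?_
    have hx' := hA.2 hx
    have k1 := hm hx' ss hx'.2
    have k2 := hm ⟨le_rfl, has⟩ hx' hx'.1
    rw [lt_div_iff₀ (by linarith)] at hh
    rw [Real.norm_eq_abs, abs_le]
    constructor <;> nlinarith
  set P₁ := algebraMap ℝ (H →L[ℂ] H) (χ₁ s) - Q₁ with hP₁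
  set P₂ := algebraMap ℝ (H →L[ℂ] H) (χ₂ s) - Q₂ with hP₂
  set β : ℝ → ℝ := fun x => (χ₁ s + χ₂ s) - (χ₁ x + χ₂ x) with hβ
  have hβc : ContinuousOn β (Icc a s) := by fun_prop
  set B := cfc β (CFC.abs (star W)) with hB
  have hB' : B = algebraMap ℝ (H →L[ℂ] H) (χ₁ s) + algebraMap ℝ (H →L[ℂ] H) (χ₂ s) - (Q₁' + Q₂) := by
    have k1 := c₁.mono hmem'.2
    have k2 := c₂.mono hmem'.2
    rw [hB, hβ, cfc_sub (fun _ => χ₁ s + χ₂ s) (fun x => χ₁ x + χ₂ x) _ (by fun_prop) (by fun_prop),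
      cfc_const _ _ hmem'.1, cfc_add (CFC.abs (star W)) (fun x => χ₁ x) (fun x => χ₂ x) k1 k2, map_add]
  -- The relation `W χ₁(|W|) = χ₁(|W*|) W` moves one term to the left of `W`; the added constants
  -- `χ₁(s)` and `χ₂(s)` cancel.
  have hD : ⁅opPhi χ₁ χ₂ W, W⁆ = B * W - P₁ * W - W * P₂ := by
    have k1 : W * algebraMap ℝ (H →L[ℂ] H) (χ₂ s) = algebraMap ℝ (H →L[ℂ] H) (χ₂ s) * W :=
      (Algebra.commutes _ _).symm
    have k2 : opPhi χ₁ χ₂ W = Q₁ - Q₂ := rfl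
    rw [Ring.lie_def, k2, hB', hP₁, hP₂, mul_sub, mul_sub, k1]
    simp only [sub_mul, add_mul]
    rw [hint]
    abel
  set c : ℝ := ‖P₁ * B * W‖ + ‖B * W * P₂‖ + ‖P₁ * W * P₂‖ + ‖P₁ * B * W * P₂‖ with hcdef
  have hc0 : 0 ≤ c := by positivity
  have hsmall : ∀ᶠ h in 𝓝[>] (0 : ℝ), h < min 1 (ε / 2 / (c + 1)) :=
    nhdsWithin_le_nhds (eventually_lt_nhds (by positivity))
  have hmain := eventually_mul_one_add_le ha has hβc
    (fun x hx => sub_nonneg.2 (add_le_add (m₁ hx ss hx.2) (m₂ hx ss hx.2))) (sub_self _)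
    (half_pos hε)
  filter_upwards [contr χ₁ _ c₁ m₁ hmem, contr χ₂ _ c₂ m₂ hmem', hsmall, hmain,
    self_mem_nhdsWithin] with h k₁ k₂ hh hβh hpos
  have hpos : 0 < h := hpos
  have hh1 : h < 1 := hh.trans_le (min_le_left _ _)
  have hh2 : h * (c + 1) < ε / 2 := by
    rw [← lt_div_iff₀ (by positivity)]
    exact hh.trans_le (min_le_right _ _)
  have hM : ‖(1 + h • B) * W‖ ≤ s + ε / 2 * h := by
    have e : 1 + h • B = cfc (fun x => 1 + h * β x) (CFC.abs (star W)) := by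
      have k1 := hβc.mono hmem'.2
      rw [cfc_add (CFC.abs (star W)) (fun _ => (1 : ℝ)) (fun x => h * β x) (by fun_prop) (by fun_prop),
        cfc_const_one ℝ _ hmem'.1, cfc_const_mul h β _ k1]
    rw [e]
    exact norm_cfc_cfcAbs_star_mul_le ha hW (by fun_prop) (by positivity) hβh
  have hprod : ‖(1 - h • P₁) * ((1 + h • B) * W) * (1 - h • P₂)‖ ≤ s + ε / 2 * h := by
    refine (norm_mul_le _ _).trans ((mul_le_of_le_one_right (norm_nonneg _) k₂).trans ?_)
    exact (norm_mul_le _ _).trans ((mul_le_of_le_one_left (norm_nonneg _) k₁).trans hM)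
  -- The linear terms in `h` agree with the product, whose factors are already controlled; the rest
  -- is of order `h²`.
  have hexp : W + h • ⁅opPhi χ₁ χ₂ W, W⁆ =
      (1 - h • P₁) * ((1 + h • B) * W) * (1 - h • P₂) +
        ((h ^ 2) • (P₁ * B * W + B * W * P₂ - P₁ * W * P₂) - (h ^ 3) • (P₁ * B * W * P₂)) := by
    rw [hD]
    simp only [sub_mul, mul_sub, add_mul, mul_add, one_mul, mul_one, smul_mul_assoc,
      mul_smul_comm, smul_sub, smul_add, smul_smul, pow_succ, pow_zero, mul_assoc]
    abel
  have herr : ‖(h ^ 2) • (P₁ * B * W + B * W * P₂ - P₁ * W * P₂) - (h ^ 3) • (P₁ * B * W * P₂)‖ ≤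
      h ^ 2 * c := by
    have k3 : ‖P₁ * B * W + B * W * P₂ - P₁ * W * P₂‖ ≤
        ‖P₁ * B * W‖ + ‖B * W * P₂‖ + ‖P₁ * W * P₂‖ :=
      (norm_sub_le _ _).trans (by gcongr; exact norm_add_le _ _)
    refine (norm_sub_le _ _).trans ?_
    rw [norm_smul, norm_smul, Real.norm_of_nonneg (by positivity),
      Real.norm_of_nonneg (by positivity)]
    have k4 : h ^ 3 * ‖P₁ * B * W * P₂‖ ≤ h ^ 2 * ‖P₁ * B * W * P₂‖ :=
      mul_le_mul_of_nonneg_right (pow_le_pow_of_le_one hpos.le hh1.le (by norm_num))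
        (norm_nonneg _)
    have k5 := mul_le_mul_of_nonneg_left k3 (by positivity : (0 : ℝ) ≤ h ^ 2)
    rw [hcdef]
    linarith
  rw [hexp]
  refine (norm_add_le _ _).trans ((add_le_add hprod herr).trans ?_)
  nlinarith

/-- A curve whose velocity does not increase the norm to first order has non-increasing norm. -/
theorem norm_le_of_forall_eventually_norm_add_smul_le {E : Type*} [NormedAddCommGroup E]
    [NormedSpace ℝ E] {W : ℝ → E} {t₀ t₁ : ℝ} (hc : ContinuousOn W (Icc t₀ t₁))
    (hW : ∀ t ∈ Ico t₀ t₁, ∃ (c : ℝ) (D : E), 0 ≤ c ∧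
      (∀ ε : ℝ, 0 < ε → ∀ᶠ h in 𝓝[>] (0 : ℝ), ‖W t + h • D‖ ≤ ‖W t‖ + ε * h) ∧
      HasDerivWithinAt W (c • D) (Ioi t) t) {t : ℝ} (ht : t ∈ Icc t₀ t₁) : ‖W t‖ ≤ ‖W t₀‖ := by
  refine image_le_of_liminf_slope_right_le_deriv_boundary (f := fun t => ‖W t‖)
    (B := fun _ => ‖W t₀‖) (B' := fun _ => 0) hc.norm le_rfl continuousOn_const
    (fun x _ => hasDerivWithinAt_const _ _ _) (fun x hx r hr => ?_) ht
  obtain ⟨c, D, hc0, hD, hder⟩ := hW x hx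
  refine Eventually.frequently ?_
  -- The time change is absorbed by using the step `c h` along `D`.
  have h1 : ∀ᶠ h in 𝓝[>] (0 : ℝ), ‖W x + h • (c • D)‖ ≤ ‖W x‖ + r / 2 * h := by
    rcases hc0.eq_or_lt with h0 | h0
    · filter_upwards [self_mem_nhdsWithin] with h hh
      have hh : 0 < h := hh
      rw [← h0, zero_smul, smul_zero, add_zero]
      nlinarith
    · have hε : 0 < r / 2 / c := by positivity
      have ht : Tendsto (fun h : ℝ => c * h) (𝓝[>] 0) (𝓝[>] 0) := by
        refine tendsto_nhdsWithin_iff.2 ⟨?_, ?_⟩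
        · have : Tendsto (fun h : ℝ => c * h) (𝓝 0) (𝓝 (c * 0)) := tendsto_id.const_mul c
          rw [mul_zero] at this
          exact this.mono_left nhdsWithin_le_nhds
        · filter_upwards [self_mem_nhdsWithin] with h hh
          exact mul_pos h0 hh
      filter_upwards [ht.eventually (hD _ hε)] with h hh
      rw [smul_smul, mul_comm h c]
      refine hh.trans (le_of_eq ?_)
      field_simp
  have h2 : Tendsto (fun z => z - x) (𝓝[>] x) (𝓝[>] 0) := by
    refine tendsto_nhdsWithin_iff.2 ⟨?_, ?_⟩
    · have : Tendsto (fun z : ℝ => z - x) (𝓝 x) (𝓝 (x - x)) := tendsto_id.sub_const x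
      rw [sub_self] at this
      exact this.mono_left nhdsWithin_le_nhds
    · filter_upwards [self_mem_nhdsWithin] with z hz
      exact mem_Ioi.2 (sub_pos.2 (mem_Ioi.1 hz))
  have h3 := hder.isLittleO.def (show (0 : ℝ) < r / 4 by positivity)
  filter_upwards [h2.eventually h1, h3, self_mem_nhdsWithin] with z hz1 hz2 hz
  have hz : 0 < z - x := sub_pos.2 (mem_Ioi.1 hz)
  rw [slope_def_field, div_lt_iff₀ hz]
  rw [Real.norm_of_nonneg hz.le] at hz2
  have h4 : ‖W z‖ ≤ ‖W z - W x - (z - x) • c • D‖ + ‖W x + (z - x) • (c • D)‖ := by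
    refine le_of_eq_of_le ?_ (norm_add_le _ _)
    congr 1
    abel
  nlinarith

end Decay

/-! ### Differential equations with a cutoff vector field -/

section RadialCutoff

variable {E : Type*} [NormedAddCommGroup E]

/-- Cut a cutoff function off outside a ball. -/
def radialCutoff (χ : E → ℝ) (R : ℝ) (x : E) : ℝ := max 0 (χ x - max 0 (‖x‖ - R))

theorem radialCutoff_nonneg (χ : E → ℝ) (R : ℝ) (x : E) : 0 ≤ radialCutoff χ R x :=
  le_max_left _ _

theorem radialCutoff_eq {χ : E → ℝ} (h0 : ∀ x, 0 ≤ χ x) {R : ℝ} {x : E} (hx : ‖x‖ ≤ R) :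
    radialCutoff χ R x = χ x := by
  rw [radialCutoff, max_eq_left (by linarith : ‖x‖ - R ≤ 0), sub_zero, max_eq_right (h0 x)]

theorem radialCutoff_le (χ : E → ℝ) (h0 : ∀ x, 0 ≤ χ x) (R : ℝ) (x : E) :
    radialCutoff χ R x ≤ χ x :=
  max_le (h0 x) (sub_le_self _ (le_max_left _ _))

theorem norm_le_of_radialCutoff_ne_zero {χ : E → ℝ} (h1 : ∀ x, χ x ≤ 1) {R : ℝ} {x : E}
    (hx : radialCutoff χ R x ≠ 0) : ‖x‖ ≤ R + 1 := by
  by_contra! h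
  refine hx (max_eq_left ?_)
  linarith [h1 x, le_max_right 0 (‖x‖ - R)]

theorem abs_radialCutoff_sub_le {χ : E → ℝ} {L : ℝ} (hχ : ∀ x y, |χ x - χ y| ≤ L * ‖x - y‖)
    (R : ℝ) (x y : E) : |radialCutoff χ R x - radialCutoff χ R y| ≤ (L + 1) * ‖x - y‖ := by
  rw [radialCutoff, radialCutoff, max_comm 0, max_comm 0, max_comm 0, max_comm 0]
  refine (abs_max_sub_max_le_abs _ _ _).trans ?_
  have e : χ x - max (‖x‖ - R) 0 - (χ y - max (‖y‖ - R) 0) =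
      (χ x - χ y) - (max (‖x‖ - R) 0 - max (‖y‖ - R) 0) := by ring
  have h2 : |max (‖x‖ - R) 0 - max (‖y‖ - R) 0| ≤ ‖x - y‖ := by
    refine (abs_max_sub_max_le_abs _ _ _).trans ?_
    rw [sub_sub_sub_cancel_right]
    exact abs_norm_sub_norm_le x y
  rw [e, add_mul, one_mul]
  exact (abs_sub _ _).trans (add_le_add (hχ x y) h2)

end RadialCutoff

section CutoffODE

variable {E : Type*} [NormedAddCommGroup E] [NormedSpace ℝ E]

/-- A time-dependent vector field `v` of linear growth on `[0, N]`, Lipschitz where the cutoff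
function `χ` does not vanish. -/
structure IsCutoffField (v : ℝ → E → E) (χ : E → ℝ) (N K c L : ℝ) : Prop where
  growth_nonneg : 0 ≤ K
  bound_nonneg : 0 ≤ c
  lip_nonneg : 0 ≤ L
  nonneg : ∀ x, 0 ≤ χ x
  le_one : ∀ x, χ x ≤ 1
  lip : ∀ x y, |χ x - χ y| ≤ L * ‖x - y‖
  field_lip : ∀ t ∈ Icc 0 N, ∀ x y, χ x ≠ 0 → χ y ≠ 0 → ‖v t x - v t y‖ ≤ K * ‖x - y‖
  field_bound : ∀ t ∈ Icc 0 N, ∀ x, χ x ≠ 0 → ‖v t x‖ ≤ K * ‖x‖ + c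
  field_cont : ∀ x, χ x ≠ 0 → ContinuousOn (fun t => v t x) (Icc 0 N)

/-- No control of `v` is needed where `χ` vanishes: if `χ y = 0`, then `χ x` is itself the
difference `χ x - χ y`, hence at most `L‖x - y‖`. -/
theorem norm_smul_sub_smul_le_of_cutoff {χ : E → ℝ} {v : E → E} {K L M : ℝ} (hK : 0 ≤ K)
    (hL : 0 ≤ L) (hM : 0 ≤ M) (h0 : ∀ x, 0 ≤ χ x) (h1 : ∀ x, χ x ≤ 1)
    (hχ : ∀ x y, |χ x - χ y| ≤ L * ‖x - y‖)
    (hv : ∀ x y, χ x ≠ 0 → χ y ≠ 0 → ‖v x - v y‖ ≤ K * ‖x - y‖)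
    (hb : ∀ x, χ x ≠ 0 → ‖v x‖ ≤ M) (x y : E) :
    ‖χ x • v x - χ y • v y‖ ≤ (L * M + K) * ‖x - y‖ := by
  have key : ∀ x y, χ x ≠ 0 → ‖(χ x - χ y) • v x‖ ≤ L * M * ‖x - y‖ := fun x y hx => by
    rw [norm_smul, Real.norm_eq_abs]
    calc |χ x - χ y| * ‖v x‖ ≤ (L * ‖x - y‖) * M :=
          mul_le_mul (hχ x y) (hb x hx) (norm_nonneg _) (by positivity)
      _ = L * M * ‖x - y‖ := by ring
  have hn := norm_nonneg (x - y)
  by_cases hx : χ x = 0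
  · by_cases hy : χ y = 0
    · rw [hx, hy, zero_smul, zero_smul, sub_zero, norm_zero]
      positivity
    · have := key y x hy
      rw [hx, sub_zero, norm_sub_rev] at this
      rw [hx, zero_smul, zero_sub, norm_neg]
      nlinarith
  · have k1 := key x y hx
    by_cases hy : χ y = 0
    · rw [hy, sub_zero] at k1
      rw [hy, zero_smul, sub_zero]
      nlinarith
    · have e : χ x • v x - χ y • v y = (χ x - χ y) • v x + χ y • (v x - v y) := by
        rw [sub_smul, smul_sub]
        abel
      have k2 : ‖χ y • (v x - v y)‖ ≤ K * ‖x - y‖ := by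
        rw [norm_smul, Real.norm_of_nonneg (h0 y)]
        exact (mul_le_of_le_one_left (norm_nonneg _) (h1 y)).trans (hv x y hx hy)
      rw [e, add_mul]
      exact (norm_add_le _ _).trans (add_le_add k1 k2)

theorem exists_hasDerivWithinAt_Icc_of_bounded [CompleteSpace E] {v : ℝ → E → E} {N K M : ℝ}
    (hN : 0 ≤ N) (hK : 0 ≤ K) (hM : 0 ≤ M)
    (hv : ∀ t ∈ Icc 0 N, ∀ x y, ‖v t x - v t y‖ ≤ K * ‖x - y‖)
    (hb : ∀ t ∈ Icc 0 N, ∀ x, ‖v t x‖ ≤ M)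
    (hc : ∀ x, ContinuousOn (fun t => v t x) (Icc 0 N)) (x₀ : E) :
    ∃ f : ℝ → E, f 0 = x₀ ∧ ∀ t ∈ Icc 0 N, HasDerivWithinAt f (v t (f t)) (Icc 0 N) t := by
  -- A field bounded by `M` cannot leave the ball of radius `M N` in time `N`, so one application
  -- covers the whole interval.
  have hPL : IsPicardLindelof v (⟨0, le_rfl, hN⟩ : Icc (0 : ℝ) N) x₀ (M * N).toNNReal 0
      M.toNNReal K.toNNReal := by
    refine ⟨fun t ht => ?_, fun x _ => hc x, fun t ht x _ => ?_, ?_⟩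
    · refine LipschitzOnWith.of_dist_le_mul fun x _ y _ => ?_
      rw [dist_eq_norm, dist_eq_norm, Real.coe_toNNReal _ hK]
      exact hv t ht x y
    · rw [Real.coe_toNNReal _ hM]
      exact hb t ht x
    · rw [Real.coe_toNNReal _ hM, Real.coe_toNNReal _ (by positivity)]
      simp [hN]
  exact hPL.exists_eq_forall_mem_Icc_hasDerivWithinAt₀

theorem HasDerivWithinAt.Ici_of_Icc {f : ℝ → E} {f' : E} {N t : ℝ}
    (h : HasDerivWithinAt f f' (Icc 0 N) t) (ht : t ∈ Ico 0 N) :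
    HasDerivWithinAt f f' (Ici t) t :=
  h.mono_of_mem_nhdsWithin (Filter.mem_of_superset (Icc_mem_nhdsGE ht.2)
    (Icc_subset_Icc_left ht.1))

/-- A priori bound for solutions of `f' = χ(f) v(t, f)`. -/
theorem IsCutoffField.norm_le {v : ℝ → E → E} {χ : E → ℝ} {N K c L : ℝ}
    (h : IsCutoffField v χ N K c L) {f : ℝ → E} {χ' : E → ℝ} (h0 : ∀ x, 0 ≤ χ' x)
    (hχ' : ∀ x, χ' x ≤ χ x)
    (hf : ∀ t ∈ Icc 0 N, HasDerivWithinAt f (χ' (f t) • v t (f t)) (Icc 0 N) t) {t : ℝ}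
    (ht : t ∈ Icc 0 N) : ‖f t‖ ≤ gronwallBound ‖f 0‖ K c N := by
  refine (norm_le_gronwallBound_of_norm_deriv_right_le (fun t ht => (hf t ht).continuousWithinAt)
    (fun t ht => (hf t (Ico_subset_Icc_self ht)).Ici_of_Icc ht) le_rfl (K := K) (ε := c)
    (fun t ht => ?_) t ht).trans (gronwallBound_mono (norm_nonneg _) h.bound_nonneg
      h.growth_nonneg (by linarith [ht.2]))
  have hK := h.growth_nonneg
  have hc := h.bound_nonneg
  by_cases hx : χ (f t) = 0
  · rw [le_antisymm (hx ▸ hχ' (f t)) (h0 _), zero_smul, norm_zero]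
    positivity
  · rw [norm_smul, Real.norm_of_nonneg (h0 _)]
    exact (mul_le_of_le_one_left (norm_nonneg _) ((hχ' _).trans (h.le_one _))).trans
      (h.field_bound t (Ico_subset_Icc_self ht) _ hx)

theorem IsCutoffField.norm_smul_sub_smul_le {v : ℝ → E → E} {χ : E → ℝ} {N K c L : ℝ}
    (h : IsCutoffField v χ N K c L) {R : ℝ} (hR : 0 ≤ R) {t : ℝ} (ht : t ∈ Icc 0 N) (x y : E) :
    ‖radialCutoff χ R x • v t x - radialCutoff χ R y • v t y‖ ≤
      ((L + 1) * (K * (R + 1) + c) + K) * ‖x - y‖ := by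
  have hK := h.growth_nonneg
  have hc := h.bound_nonneg
  have hL := h.lip_nonneg
  have hne : ∀ x, radialCutoff χ R x ≠ 0 → χ x ≠ 0 := fun x hx h0 =>
    hx (le_antisymm (h0 ▸ radialCutoff_le χ h.nonneg R x) (radialCutoff_nonneg χ R x))
  refine norm_smul_sub_smul_le_of_cutoff hK (by positivity) (by positivity)
    (radialCutoff_nonneg χ R) (fun x => (radialCutoff_le χ h.nonneg R x).trans (h.le_one x))
    (abs_radialCutoff_sub_le h.lip R) (fun x y hx hy => h.field_lip t ht x y (hne x hx) (hne y hy))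
    (fun x hx => (h.field_bound t ht x (hne x hx)).trans ?_) x y
  gcongr
  exact norm_le_of_radialCutoff_ne_zero h.le_one hx

theorem IsCutoffField.exists_Icc [CompleteSpace E] {v : ℝ → E → E} {χ : E → ℝ} {N K c L : ℝ}
    (h : IsCutoffField v χ N K c L) (hN : 0 ≤ N) (x₀ : E) :
    ∃ f : ℝ → E, f 0 = x₀ ∧
      ∀ t ∈ Icc 0 N, HasDerivWithinAt f (χ (f t) • v t (f t)) (Icc 0 N) t := by
  have hK := h.growth_nonneg
  have hc := h.bound_nonneg
  have hL := h.lip_nonneg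
  -- `R` is the a priori bound for the equation with or without radial truncation. The truncated
  -- field is bounded and globally Lipschitz, and its solution never reaches the truncated region.
  set R : ℝ := gronwallBound ‖x₀‖ K c N with hRdef
  have hR : 0 ≤ R := by
    have := gronwallBound_mono (norm_nonneg x₀) hc hK hN
    rw [gronwallBound_x0] at this
    exact (norm_nonneg _).trans this
  have hne : ∀ x, radialCutoff χ R x ≠ 0 → χ x ≠ 0 := fun x hx h0 =>
    hx (le_antisymm (h0 ▸ radialCutoff_le χ h.nonneg R x) (radialCutoff_nonneg χ R x))
  obtain ⟨f, hf0, hf⟩ := exists_hasDerivWithinAt_Icc_of_bounded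
    (v := fun t x => radialCutoff χ R x • v t x) (M := K * (R + 1) + c) hN
    (by positivity) (by positivity) (fun t ht => h.norm_smul_sub_smul_le hR ht)
    (fun t ht x => by
      by_cases hx : radialCutoff χ R x = 0
      · rw [hx, zero_smul, norm_zero]
        positivity
      · rw [norm_smul, Real.norm_of_nonneg (radialCutoff_nonneg χ R x)]
        refine (mul_le_of_le_one_left (norm_nonneg _)
          ((radialCutoff_le χ h.nonneg R x).trans (h.le_one x))).trans
          ((h.field_bound t ht x (hne x hx)).trans ?_)
        gcongr
        exact norm_le_of_radialCutoff_ne_zero h.le_one hx)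
    (fun x => by
      by_cases hx : radialCutoff χ R x = 0
      · simp only [hx, zero_smul]
        exact continuousOn_const
      · exact (h.field_cont x (hne x hx)).const_smul _) x₀
  refine ⟨f, hf0, fun t ht => ?_⟩
  have hb := h.norm_le (radialCutoff_nonneg χ R) (radialCutoff_le χ h.nonneg R) hf ht
  rw [hf0] at hb
  rw [← radialCutoff_eq h.nonneg hb]
  exact hf t ht

theorem IsCutoffField.eqOn_Icc {v : ℝ → E → E} {χ : E → ℝ} {N K c L : ℝ}
    (h : IsCutoffField v χ N K c L) {f g : ℝ → E} (hfg : f 0 = g 0)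
    (hf : ∀ t ∈ Icc 0 N, HasDerivWithinAt f (χ (f t) • v t (f t)) (Icc 0 N) t)
    (hg : ∀ t ∈ Icc 0 N, HasDerivWithinAt g (χ (g t) • v t (g t)) (Icc 0 N) t) :
    EqOn f g (Icc 0 N) := by
  rcases lt_or_ge N 0 with hN | hN
  · rw [Icc_eq_empty (by linarith)]
    exact eqOn_empty _ _
  have hK := h.growth_nonneg
  have hc := h.bound_nonneg
  have hL := h.lip_nonneg
  set R : ℝ := gronwallBound ‖f 0‖ K c N with hRdef
  have hfR : ∀ t ∈ Icc 0 N, ‖f t‖ ≤ R := fun t ht => h.norm_le h.nonneg (fun _ => le_rfl) hf ht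
  have hgR : ∀ t ∈ Icc 0 N, ‖g t‖ ≤ R := fun t ht => by
    rw [hRdef, hfg]
    exact h.norm_le h.nonneg (fun _ => le_rfl) hg ht
  have hR : 0 ≤ R := (norm_nonneg _).trans (hfR 0 ⟨le_rfl, hN⟩)
  refine ODE_solution_unique_of_mem_Icc_right (s := fun _ => univ)
    (v := fun t x => radialCutoff χ R x • v t x)
    (K := ((L + 1) * (K * (R + 1) + c) + K).toNNReal) (fun t ht => ?_)
    (fun t ht => (hf t ht).continuousWithinAt) (fun t ht => ?_) (fun _ _ => mem_univ _)
    (fun t ht => (hg t ht).continuousWithinAt) (fun t ht => ?_) (fun _ _ => mem_univ _) hfg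
  · refine LipschitzOnWith.of_dist_le_mul fun x _ y _ => ?_
    rw [dist_eq_norm, dist_eq_norm, Real.coe_toNNReal _ (by positivity)]
    exact h.norm_smul_sub_smul_le hR (Ico_subset_Icc_self ht) x y
  · have ht' := Ico_subset_Icc_self ht
    rw [radialCutoff_eq h.nonneg (hfR t ht')]
    exact (hf t ht').Ici_of_Icc ht
  · have ht' := Ico_subset_Icc_self ht
    rw [radialCutoff_eq h.nonneg (hgR t ht')]
    exact (hg t ht').Ici_of_Icc ht

theorem IsCutoffField.exists_Ici [CompleteSpace E] {v : ℝ → E → E} {χ : E → ℝ} {K c L : ℝ}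
    (h : ∀ N, IsCutoffField v χ N K c L) (x₀ : E) :
    ∃ f : ℝ → E, f 0 = x₀ ∧
      ∀ t, 0 ≤ t → HasDerivWithinAt f (χ (f t) • v t (f t)) (Ici 0) t := by
  have hex : ∀ N : ℝ, ∃ f : ℝ → E, f 0 = x₀ ∧
      ∀ t ∈ Icc 0 N, HasDerivWithinAt f (χ (f t) • v t (f t)) (Icc 0 N) t := fun N => by
    rcases lt_or_ge N 0 with hN | hN
    · exact ⟨fun _ => x₀, rfl, fun t ht => absurd (ht.1.trans ht.2) hN.not_ge⟩
    · exact (h N).exists_Icc hN x₀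
  choose F hF0 hF using hex
  have hEq : ∀ N N', N ≤ N' → EqOn (F N) (F N') (Icc 0 N) := fun N N' hNN =>
    (h N).eqOn_Icc ((hF0 N).trans (hF0 N').symm) (hF N) fun t ht =>
      (hF N' t (Icc_subset_Icc_right hNN ht)).mono (Icc_subset_Icc_right hNN)
  -- The shift by `1` keeps `t` away from the right endpoint. Near `t` the glued function agrees
  -- with the single solution `F (t + 2)`.
  refine ⟨fun t => F (t + 1) t, hF0 _, fun t ht => ?_⟩
  have hloc : ∀ s ∈ Icc 0 (t + 1), F (s + 1) s = F (t + 2) s := fun s hs =>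
    hEq _ _ (by linarith [hs.2]) ⟨hs.1, by linarith⟩
  have hn : ∀ r, t < r → Icc 0 r ∈ 𝓝[Ici 0] t := fun r hr => by
    rw [← Ici_inter_Iic]
    exact inter_mem_nhdsWithin _ (Iic_mem_nhds hr)
  have hd := (hF (t + 2) t ⟨ht, by linarith⟩).mono_of_mem_nhdsWithin (hn _ (by linarith))
  rw [← hloc t ⟨ht, by linarith⟩] at hd
  exact hd.congr_of_eventuallyEq (Filter.mem_of_superset (hn (t + 1) (by linarith)) hloc)
    (hloc t ⟨ht, by linarith⟩)

/-- Global existence for linear inhomogeneous equations. -/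
theorem exists_hasDerivWithinAt_Icc_of_lipschitz [CompleteSpace E] {v : ℝ → E → E} {N K c : ℝ}
    (hN : 0 ≤ N) (hK : 0 ≤ K) (hc : 0 ≤ c)
    (hv : ∀ t ∈ Icc 0 N, ∀ x y, ‖v t x - v t y‖ ≤ K * ‖x - y‖)
    (hb : ∀ t ∈ Icc 0 N, ‖v t 0‖ ≤ c)
    (hcont : ∀ x, ContinuousOn (fun t => v t x) (Icc 0 N)) (x₀ : E) :
    ∃ f : ℝ → E, f 0 = x₀ ∧ ∀ t ∈ Icc 0 N, HasDerivWithinAt f (v t (f t)) (Icc 0 N) t := by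
  have h : IsCutoffField v (fun _ => 1) N K c 0 := by
    refine ⟨hK, hc, le_rfl, fun _ => zero_le_one, fun _ => le_rfl, fun x y => by simp,
      fun t ht x y _ _ => hv t ht x y, fun t ht x _ => ?_, fun x _ => hcont x⟩
    have h1 := hv t ht x 0
    rw [sub_zero] at h1
    have h2 : ‖v t x‖ ≤ ‖v t x - v t 0‖ + ‖v t 0‖ := by
      simpa using norm_add_le (v t x - v t 0) (v t 0)
    linarith [hb t ht]
  simpa using h.exists_Icc hN x₀

end CutoffODE

/-! ### Invariance of annuli under the flow -/

section Invariance

variable {H : Type*} [NormedAddCommGroup H] [InnerProductSpace ℂ H] [CompleteSpace H]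

open Filter

theorem Annulus.le_norm [Nontrivial H] {a b : ℝ} {X : H →L[ℂ] H} (h : Annulus a b X) :
    a ≤ ‖X‖ := by
  obtain ⟨v, hv⟩ := exists_ne (0 : H)
  exact le_of_mul_le_mul_right ((h.le_apply v).trans (X.le_opNorm v)) (norm_pos_iff.2 hv)

theorem Annulus.inverse {a b : ℝ} (ha : 0 < a) (hb : 0 < b) {X : H →L[ℂ] H} (h : Annulus a b X) :
    Annulus b⁻¹ a⁻¹ (Ring.inverse X) := by
  have hX := h.isUnit ha
  have key : ∀ Y W : H →L[ℂ] H, Y * W = 1 → ‖Y‖ ≤ b → ∀ v, b⁻¹ * ‖v‖ ≤ ‖W v‖ := by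
    intro Y W hYW hY v
    have h1 := Y.le_of_opNorm_le hY (W v)
    rw [← mul_apply_eq_comp, hYW, one_apply_eq_self] at h1
    rw [inv_mul_eq_div, div_le_iff₀ hb, mul_comm]
    exact h1
  refine ⟨h.norm_inverse_le ha, key X _ (Ring.mul_inverse_cancel X hX) h.norm_le,
    key (star X) _ ?_ (by rw [norm_star]; exact h.norm_le)⟩
  rw [← star_mul, Ring.inverse_mul_cancel X hX, star_one]

/-- This rests on `|X⁻¹| = |X*|⁻¹`, by uniqueness of the positive square root of `(XX*)⁻¹`. -/
theorem cfc_inv_cfcAbs_inverse {a b : ℝ} (ha : 0 < a) (hab : a ≤ b) {X : H →L[ℂ] H}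
    (h : Annulus a b X) {f : ℝ → ℝ} (hf : ContinuousOn f (Icc a b)) :
    cfc (fun x => f x⁻¹) (CFC.abs (Ring.inverse X)) = cfc f (CFC.abs (star X)) := by
  have hb : 0 < b := ha.trans_le hab
  obtain ⟨u, rfl⟩ := h.isUnit ha
  have hi := h.inverse ha hb
  rw [Ring.inverse_unit] at hi ⊢
  have hinv : MapsTo (fun x : ℝ => x⁻¹) (Icc b⁻¹ a⁻¹) (Icc a b) := fun x hx => by
    have hx0 : 0 < x := (inv_pos.2 hb).trans_le hx.1
    exact ⟨(le_inv_comm₀ ha hx0).2 hx.2, (inv_le_comm₀ hx0 hb).2 hx.1⟩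
  have hs := h.star.spectrum_cfcAbs_subset ha.le
  have hP0 : 0 ≤ CFC.abs (star (u : H →L[ℂ] H)) := CFC.abs_nonneg _
  have hPP : CFC.abs (star (u : H →L[ℂ] H)) * CFC.abs (star (u : H →L[ℂ] H)) =
      ↑(u * star u) := by
    rw [CFC.abs_mul_abs, star_star, Units.val_mul, Units.coe_star]
  obtain ⟨p, hp⟩ : IsUnit (CFC.abs (star (u : H →L[ℂ] H))) :=
    (spectrum.zero_notMem_iff ℝ).1 fun h0 => by linarith [(hs h0).1]
  rw [← hp] at hP0 hPP hs ⊢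
  have hpi : 0 ≤ (↑p⁻¹ : H →L[ℂ] H) := by
    rw [← cfc_inv_id (R := ℝ) p hP0.isSelfAdjoint]
    exact cfc_nonneg fun x hx => inv_nonneg.2 (ha.le.trans (hs hx).1)
  have habs : CFC.abs (↑u⁻¹ : H →L[ℂ] H) = ↑p⁻¹ := by
    have hpp : p * p = u * star u := Units.ext hPP
    refine CFC.sqrt_unique ?_ hpi
    rw [← Units.val_mul, ← mul_inv_rev, hpp, mul_inv_rev, Units.val_mul]
    rfl
  have hsi := hi.spectrum_cfcAbs_subset (inv_pos.2 hb).le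
  rw [habs] at hsi ⊢
  rw [cfc_comp_inv f p⁻¹ (hf.mono ?_) hpi.isSelfAdjoint, inv_inv]
  rintro _ ⟨x, hx, rfl⟩
  exact hinv (hsi hx)

/-- The new pair `-φ₂(1/x)`, `-φ₁(1/x)` is again non-decreasing, so the norm decay applies to the
inverse. -/
theorem opPhi_inverse {a b : ℝ} (ha : 0 < a) (hab : a ≤ b) {φ₁ φ₂ : ℝ → ℝ}
    (h₁ : ContinuousOn φ₁ (Icc a b)) (h₂ : ContinuousOn φ₂ (Icc a b)) {X : H →L[ℂ] H}
    (h : Annulus a b X) :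
    opPhi (fun x => -φ₂ x⁻¹) (fun x => -φ₁ x⁻¹) (Ring.inverse X) = opPhi φ₁ φ₂ X := by
  have e : star (Ring.inverse X) = Ring.inverse (star X) := (Ring.inverse_star X).symm
  have k₁ := cfc_inv_cfcAbs_inverse ha hab h.star h₁
  rw [star_star] at k₁
  rw [opPhi, opPhi, e, cfc_neg (fun x => φ₂ x⁻¹), cfc_neg (fun x => φ₁ x⁻¹),
    cfc_inv_cfcAbs_inverse ha hab h h₂, k₁]
  abel

/-- Along a time change of the flow, the norm does not increase. -/
theorem norm_le_of_flow [Nontrivial H] {a b : ℝ} (ha : 0 ≤ a) {φ₁ φ₂ : ℝ → ℝ}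
    (c₁ : ContinuousOn φ₁ (Icc a b)) (c₂ : ContinuousOn φ₂ (Icc a b))
    (m₁ : MonotoneOn φ₁ (Icc a b)) (m₂ : MonotoneOn φ₂ (Icc a b)) {W : ℝ → (H →L[ℂ] H)}
    {c : ℝ → ℝ} (hc : ∀ t, 0 ≤ c t) {t₀ t₁ : ℝ} (hcont : ContinuousOn W (Icc t₀ t₁))
    (hmem : ∀ t ∈ Ico t₀ t₁, Annulus a b (W t))
    (hder : ∀ t ∈ Ico t₀ t₁, HasDerivWithinAt W (c t • ⁅opPhi φ₁ φ₂ (W t), W t⁆) (Ioi t) t)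
    {t : ℝ} (ht : t ∈ Icc t₀ t₁) : ‖W t‖ ≤ ‖W t₀‖ := by
  refine norm_le_of_forall_eventually_norm_add_smul_le hcont (fun t ht => ?_) ht
  have hA := hmem t ht
  have hsub : Icc a ‖W t‖ ⊆ Icc a b := Icc_subset_Icc_right hA.norm_le
  exact ⟨c t, _, hc t, fun ε hε => eventually_norm_add_smul_lie_le ha hA.le_norm
    ⟨le_rfl, hA.le_apply, hA.le_star_apply⟩ (c₁.mono hsub) (c₂.mono hsub) (m₁.mono hsub)
    (m₂.mono hsub) hε, hder t ht⟩

/-- `(X⁻¹)' = -X⁻¹X'X⁻¹`, and `-X⁻¹[φ, X]X⁻¹ = [φ, X⁻¹]`: the inverse follows a flow of the same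
form. -/
theorem norm_inverse_le_of_flow [Nontrivial H] {a b : ℝ} (ha : 0 < a) (hab : a ≤ b)
    {φ₁ φ₂ : ℝ → ℝ} (c₁ : ContinuousOn φ₁ (Icc a b)) (c₂ : ContinuousOn φ₂ (Icc a b))
    (m₁ : MonotoneOn φ₁ (Icc a b)) (m₂ : MonotoneOn φ₂ (Icc a b)) {X : ℝ → (H →L[ℂ] H)}
    {c : ℝ → ℝ} (hc : ∀ t, 0 ≤ c t) {t₀ t₁ : ℝ} (hcont : ContinuousOn X (Icc t₀ t₁))
    (hmem : ∀ t ∈ Icc t₀ t₁, Annulus a b (X t))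
    (hder : ∀ t ∈ Ico t₀ t₁, HasDerivWithinAt X (c t • ⁅opPhi φ₁ φ₂ (X t), X t⁆) (Ioi t) t)
    {t : ℝ} (ht : t ∈ Icc t₀ t₁) : ‖Ring.inverse (X t)‖ ≤ ‖Ring.inverse (X t₀)‖ := by
  have hb : 0 < b := ha.trans_le hab
  have hinv : MapsTo (fun x : ℝ => x⁻¹) (Icc b⁻¹ a⁻¹) (Icc a b) := fun x hx => by
    have hx0 : 0 < x := (inv_pos.2 hb).trans_le hx.1
    exact ⟨(le_inv_comm₀ ha hx0).2 hx.2, (inv_le_comm₀ hx0 hb).2 hx.1⟩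
  have hci : ContinuousOn (fun x : ℝ => x⁻¹) (Icc b⁻¹ a⁻¹) :=
    continuousOn_inv₀.mono fun x hx => ((inv_pos.2 hb).trans_le hx.1).ne'
  have hanti : ∀ φ : ℝ → ℝ, MonotoneOn φ (Icc a b) →
      MonotoneOn (fun x => -φ x⁻¹) (Icc b⁻¹ a⁻¹) := fun φ hφ x hx y hy hxy => by
    have hx0 : 0 < x := (inv_pos.2 hb).trans_le hx.1
    exact neg_le_neg (hφ (hinv hy) (hinv hx) (inv_anti₀ hx0 hxy))
  refine norm_le_of_flow (W := fun t => Ring.inverse (X t)) (φ₁ := fun x => -φ₂ x⁻¹)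
    (φ₂ := fun x => -φ₁ x⁻¹) (inv_pos.2 hb).le
    (c₂.comp hci hinv).neg (c₁.comp hci hinv).neg (hanti φ₂ m₂) (hanti φ₁ m₁) hc
    (fun t ht => ?_) (fun t ht => (hmem t (Ico_subset_Icc_self ht)).inverse ha hb)
    (fun t ht => ?_) ht
  · obtain ⟨u, hu⟩ := (hmem t ht).isUnit ha
    have := NormedRing.inverse_continuousAt u
    rw [hu] at this
    exact this.comp_continuousWithinAt (hcont t ht)
  · have hA := hmem t (Ico_subset_Icc_self ht)
    rw [opPhi_inverse ha hab c₁ c₂ hA]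
    obtain ⟨u, hu⟩ := hA.isUnit ha
    have hF := hasFDerivAt_ringInverse (𝕜 := ℝ) u
    rw [hu] at hF
    refine (hF.comp_hasDerivWithinAt t (hder t ht)).congr_deriv ?_
    have e1 : (↑u⁻¹ : H →L[ℂ] H) * X t = 1 := by rw [← hu, Units.inv_mul]
    have e2 : X t * (↑u⁻¹ : H →L[ℂ] H) = 1 := by rw [← hu, Units.mul_inv]
    rw [← hu, Ring.inverse_unit, hu]
    simp only [neg_apply, ContinuousLinearMap.mulLeftRight_apply,
      mul_smul_comm, smul_mul_assoc, Ring.lie_def, mul_sub, sub_mul]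
    rw [mul_assoc (↑u⁻¹ : H →L[ℂ] H) (_ * X t), mul_assoc _ (X t), e2, mul_one,
      ← mul_assoc (↑u⁻¹ : H →L[ℂ] H) (X t), e1, one_mul, ← smul_neg, neg_sub]

/-- The annulus `α ≤ |X|, |X*| ≤ β` is invariant under time changes of the flow. -/
theorem annulus_of_flow [Nontrivial H] {a b α β δ : ℝ} (ha : 0 ≤ a) (hab : a ≤ b)
    (hα : α ≤ 0 ∨ 0 < a ∧ 0 < α) {φ₁ φ₂ : ℝ → ℝ}
    (c₁ : ContinuousOn φ₁ (Icc a b)) (c₂ : ContinuousOn φ₂ (Icc a b))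
    (m₁ : MonotoneOn φ₁ (Icc a b)) (m₂ : MonotoneOn φ₂ (Icc a b)) (hδ : 0 < δ)
    (hαβ : ∀ A B : H →L[ℂ] H, Annulus α β A → ‖B - A‖ < δ → Annulus a b B)
    {X : ℝ → (H →L[ℂ] H)} {c : ℝ → ℝ} (hc : ∀ t, 0 ≤ c t) (h0 : Annulus α β (X 0))
    (hder : ∀ t, 0 ≤ t →
      HasDerivWithinAt X (c t • ⁅opPhi φ₁ φ₂ (X t), X t⁆) (Ici 0) t) {t : ℝ} (ht : 0 ≤ t) :
    Annulus α β (X t) := by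
  have hcont : ContinuousOn X (Ici 0) := fun t ht => (hder t ht).continuousWithinAt
  have hclosed : IsClosed {A : H →L[ℂ] H | Annulus α β A} := by
    have : {A : H →L[ℂ] H | Annulus α β A} = {A | ‖A‖ ≤ β} ∩
        ((⋂ v : H, {A | α * ‖v‖ ≤ ‖A v‖}) ∩ ⋂ v : H, {A | α * ‖v‖ ≤ ‖(star A : H →L[ℂ] H) v‖}) := by
      ext A
      simp only [mem_inter_iff, mem_iInter, mem_ofPred_eq]
      exact ⟨fun h => ⟨h.norm_le, h.le_apply, h.le_star_apply⟩, fun h => ⟨h.1, h.2.1, h.2.2⟩⟩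
    rw [this]
    refine (isClosed_le continuous_norm continuous_const).inter
      ((isClosed_iInter fun v => ?_).inter (isClosed_iInter fun v => ?_))
    · exact isClosed_le continuous_const (by fun_prop)
    · have : Continuous fun A : H →L[ℂ] H => (star A : H →L[ℂ] H) v :=
        (ContinuousLinearMap.apply ℂ H v).continuous.comp continuous_star
      exact isClosed_le continuous_const this.norm
  have hsub : Icc 0 t ⊆ {s | Annulus α β (X s)} := by
    -- Continuous induction: the good times form a closed set. From a good time, the curve stays for
    -- a while within `δ`, hence in the larger annulus where the monotonicity of `φ₁`, `φ₂` gives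
    -- decay.
    refine IsClosed.Icc_subset_of_forall_exists_gt ?_ h0 ?_
    · rw [inter_comm]
      exact (hcont.mono Icc_subset_Ici_self).preimage_isClosed_of_isClosed isClosed_Icc hclosed
    · rintro x ⟨hx, hx0, -⟩ y hy
      have hxy : x < y := hy
      have hev : ∀ᶠ s in 𝓝[≥] x, ‖X s - X x‖ < δ := by
        have h1 : ContinuousWithinAt X (Ici x) x := (hcont x hx0).mono (Ici_subset_Ici.2 hx0)
        have h2 := (Metric.tendsto_nhds.1 h1) δ hδ
        simpa only [dist_eq_norm] using h2
      obtain ⟨r, hr, hrs⟩ := (mem_nhdsGE_iff_exists_Icc_subset).1 hev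
      have hr : x < r := hr
      set z := min r y with hz
      have hxz : x < z := lt_min hr hxy
      have hmem : ∀ s ∈ Icc x z, Annulus a b (X s) := fun s hs =>
        hαβ _ _ hx (hrs ⟨hs.1, hs.2.trans (min_le_left _ _)⟩)
      have hcz : ContinuousOn X (Icc x z) :=
        hcont.mono fun s hs => hx0.trans hs.1
      have hdz : ∀ s ∈ Ico x z,
          HasDerivWithinAt X (c s • ⁅opPhi φ₁ φ₂ (X s), X s⁆) (Ioi s) s := fun s hs =>
        (hder s (hx0.trans hs.1)).mono fun w hw => (hx0.trans hs.1).trans (le_of_lt hw)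
      have hzz : z ∈ Icc x z := ⟨hxz.le, le_rfl⟩
      have hn : ‖X z‖ ≤ β := (norm_le_of_flow ha c₁ c₂ m₁ m₂ hc hcz
        (fun s hs => hmem s (Ico_subset_Icc_self hs)) hdz hzz).trans hx.norm_le
      refine ⟨z, ?_, hxz, min_le_right _ _⟩
      -- For `α ≤ 0` the lower bounds are vacuous; otherwise they come from the norm of the inverse.
      rcases hα with hα | ⟨ha0, hα⟩
      · exact Annulus.of_nonpos hα hn
      · exact Annulus.of_norm_inverse_le hα hn ((hmem z hzz).isUnit ha0)
          ((norm_inverse_le_of_flow ha0 hab c₁ c₂ m₁ m₂ hc hcz hmem hdz hzz).trans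
            (hx.norm_inverse_le hα))
  exact hsub ⟨ht, le_rfl⟩

end Invariance

/-! ### Similarity orbits of Lie flows -/

section Orbits

variable {R : Type*} [NormedRing R] [NormedAlgebra ℝ R]

/-- If `g' = A g`, `g(0) = 1` and `X' = [A, X]`, then `g` is invertible and `X = g X(0) g⁻¹`. -/
theorem exists_unit_conj_of_lie_flow [CompleteSpace R] {A X g : ℝ → R} {N : ℝ} (hN : 0 ≤ N)
    (hA : ContinuousOn A (Icc 0 N))
    (hX : ∀ t ∈ Icc 0 N, HasDerivWithinAt X ⁅A t, X t⁆ (Icc 0 N) t) (hg0 : g 0 = 1)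
    (hg : ∀ t ∈ Icc 0 N, HasDerivWithinAt g (A t * g t) (Icc 0 N) t) :
    ∃ u : Rˣ, (u : R) = g N ∧ X N = (u : R) * X 0 * ((u⁻¹ : Rˣ) : R) := by
  obtain ⟨M, hM⟩ := (isCompact_Icc.image_of_continuousOn hA.norm).bddAbove
  have hM' : ∀ t ∈ Icc 0 N, ‖A t‖ ≤ M := fun t ht => hM ⟨t, ht, rfl⟩
  have hM0 : 0 ≤ M := (norm_nonneg _).trans (hM' 0 ⟨le_rfl, hN⟩)
  have hNN : N ∈ Icc 0 N := ⟨hN, le_rfl⟩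
  -- The candidate inverse of `g` solves `k' = -kA`, so that `kg` and `kXg` are constant.
  obtain ⟨k, hk0, hk⟩ := exists_hasDerivWithinAt_Icc_of_lipschitz (v := fun t x => -(x * A t))
    (c := 0) hN hM0 le_rfl (fun t ht x y => by
      rw [neg_sub_neg, ← sub_mul, mul_comm M, norm_sub_rev x]
      exact (norm_mul_le _ _).trans (by gcongr; exact hM' t ht))
    (fun t ht => by simp) (fun x => (continuousOn_const.mul hA).neg) 1
  have const : ∀ (F : ℝ → R), (∀ t ∈ Icc 0 N, HasDerivWithinAt F 0 (Icc 0 N) t) → F N = F 0 :=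
    fun F hF => constant_of_has_deriv_right_zero (fun t ht => (hF t ht).continuousWithinAt)
      (fun t ht => (hF t (Ico_subset_Icc_self ht)).Ici_of_Icc ht) N hNN
  have hkg : k N * g N = 1 := by
    have := const (fun t => k t * g t) fun t ht => ((hk t ht).mul (hg t ht)).congr_deriv (by
      noncomm_ring)
    simpa [hk0, hg0] using this
  -- The other product is not visibly constant, but `D = gk - 1` solves the linear equation `D' = AD
  -- - DA` with `D(0) = 0`.
  have hgk : g N * k N = 1 := by
    have hd : ∀ t ∈ Icc 0 N, HasDerivWithinAt (fun t => g t * k t - 1)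
        (A t * (g t * k t - 1) - (g t * k t - 1) * A t) (Icc 0 N) t := fun t ht =>
      (((hg t ht).mul (hk t ht)).sub_const 1).congr_deriv (by noncomm_ring)
    have := eq_zero_of_abs_deriv_le_mul_abs_self_of_eq_zero_right (K := 2 * M)
      (fun t ht => (hd t ht).continuousWithinAt)
      (fun t ht => (hd t (Ico_subset_Icc_self ht)).Ici_of_Icc ht) (by simp [hk0, hg0])
      (fun t ht => by
        have hMt := hM' t (Ico_subset_Icc_self ht)
        set D := g t * k t - 1
        have h1 : ‖A t * D‖ ≤ M * ‖D‖ := (norm_mul_le _ _).trans (by gcongr)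
        have h2 : ‖D * A t‖ ≤ ‖D‖ * M := (norm_mul_le _ _).trans (by gcongr)
        linarith [norm_sub_le (A t * D) (D * A t)]) N hNN
    exact sub_eq_zero.1 this
  have hkXg : k N * X N * g N = X 0 := by
    have := const (fun t => k t * X t * g t) fun t ht =>
      (((hk t ht).mul (hX t ht)).mul (hg t ht)).congr_deriv (by
        rw [Ring.lie_def, Pi.mul_apply]
        noncomm_ring)
    simpa [hk0, hg0] using this
  refine ⟨⟨g N, k N, hgk, hkg⟩, rfl, ?_⟩
  rw [← hkXg]
  change X N = g N * (k N * X N * g N) * k N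
  rw [mul_assoc, mul_assoc, hgk, mul_one, ← mul_assoc, hgk, one_mul]

theorem ContinuousOn.of_norm_sub_le {E F : Type*} [NormedAddCommGroup E] [NormedAddCommGroup F]
    {S : Set ℝ} {f : ℝ → E} {g : ℝ → F} {C : ℝ} (hf : ContinuousOn f S)
    (h : ∀ s ∈ S, ∀ t ∈ S, ‖g s - g t‖ ≤ C * ‖f s - f t‖) : ContinuousOn g S := by
  intro t ht
  rw [ContinuousWithinAt, tendsto_iff_norm_sub_tendsto_zero]
  have h1 : Filter.Tendsto (fun s => C * ‖f s - f t‖) (𝓝[S] t) (𝓝 (C * 0)) :=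
    (tendsto_iff_norm_sub_tendsto_zero.1 (hf t ht)).const_mul C
  rw [mul_zero] at h1
  refine squeeze_zero' (Filter.Eventually.of_forall fun _ => norm_nonneg _) ?_ h1
  filter_upwards [self_mem_nhdsWithin] with s hs
  exact h s hs t ht

variable {H : Type*} [NormedAddCommGroup H] [InnerProductSpace ℂ H] [CompleteSpace H]

open NormedIdeal NormedIdeal.Space

theorem mem_similarityOrbit_of_lie_flow {A X : ℝ → (H →L[ℂ] H)}
    (hA : ContinuousOn A (Ici 0))
    (hX : ∀ t, 0 ≤ t → HasDerivWithinAt X ⁅A t, X t⁆ (Ici 0) t) {N : ℝ} (hN : 0 ≤ N) :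
    X N ∈ similarityOrbit (X 0) := by
  have hA' := hA.mono (Icc_subset_Ici_self : Icc 0 N ⊆ Ici 0)
  obtain ⟨M, hM⟩ := (isCompact_Icc.image_of_continuousOn hA'.norm).bddAbove
  have hM' : ∀ t ∈ Icc 0 N, ‖A t‖ ≤ M := fun t ht => hM ⟨t, ht, rfl⟩
  have hM0 : 0 ≤ M := (norm_nonneg _).trans (hM' 0 ⟨le_rfl, hN⟩)
  obtain ⟨g, hg0, hg⟩ := exists_hasDerivWithinAt_Icc_of_lipschitz (v := fun t x => A t * x)
    (c := 0) hN hM0 le_rfl (fun t ht x y => by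
      rw [← mul_sub]
      exact (norm_mul_le _ _).trans (by gcongr; exact hM' t ht))
    (fun t ht => by simp) (fun x => hA'.mul continuousOn_const) 1
  obtain ⟨u, -, hu⟩ := exists_unit_conj_of_lie_flow hN hA'
    (fun t ht => (hX t ht.1).mono Icc_subset_Ici_self) hg0 hg
  exact ⟨u, hu⟩

/-- The inclusion `J → B(H)`, as a real linear map. -/
def NormedIdeal.Space.valR {J : NormedIdeal H} : J.Space →L[ℝ] (H →L[ℂ] H) :=
  (valL (J := J)).restrictScalars ℝ

/-- Write `g = 1 + m`; then `m' = A + Am` is a linear equation in the ideal itself, since `A` takes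
values there. -/
theorem mem_orbit_of_lie_flow {J : NormedIdeal H} {A : ℝ → J.Space} {X : ℝ → (H →L[ℂ] H)}
    (hA : ContinuousOn A (Ici 0))
    (hX : ∀ t, 0 ≤ t → HasDerivWithinAt X ⁅(A t).val, X t⁆ (Ici 0) t) {N : ℝ} (hN : 0 ≤ N) :
    X N ∈ J.orbit (X 0) := by
  have hA' := hA.mono (Icc_subset_Ici_self : Icc 0 N ⊆ Ici 0)
  obtain ⟨M, hM⟩ := (isCompact_Icc.image_of_continuousOn hA'.norm).bddAbove
  have hM' : ∀ t ∈ Icc 0 N, ‖A t‖ ≤ M := fun t ht => hM ⟨t, ht, rfl⟩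
  have hM0 : 0 ≤ M := (norm_nonneg _).trans (hM' 0 ⟨le_rfl, hN⟩)
  obtain ⟨m, hm0, hm⟩ := exists_hasDerivWithinAt_Icc_of_lipschitz
    (v := fun t x => A t + rmul (A t) x.val) (c := M) hN hM0 hM0 (fun t ht x y => by
      have e : A t + rmul (A t) x.val - (A t + rmul (A t) y.val) = rmul (A t) (x - y).val :=
        val_injective (by simp [mul_sub])
      rw [e]
      exact (norm_rmul_le _ _).trans (mul_le_mul (hM' t ht) (norm_val_le _) (norm_nonneg _) hM0))
    (fun t ht => by
      have e : A t + rmul (A t) (0 : J.Space).val = A t := val_injective (by simp)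
      rw [e]
      exact hM' t ht)
    (fun x => hA'.add (hA'.of_norm_sub_le (C := ‖x.val‖) fun s _ t _ => by
      have e : rmul (A s) x.val - rmul (A t) x.val = rmul (A s - A t) x.val :=
        val_injective (by simp [sub_mul])
      rw [e, mul_comm]
      exact norm_rmul_le _ _)) 0
  have hAv : ContinuousOn (fun t => (A t).val) (Icc 0 N) :=
    (valL (J := J)).continuous.comp_continuousOn hA'
  obtain ⟨u, hu1, hu⟩ := exists_unit_conj_of_lie_flow (g := fun t => 1 + (m t).val) hN hAv
    (fun t ht => (hX t ht.1).mono Icc_subset_Ici_self) (by simp [hm0]) (fun t ht => by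
      refine (((valR (J := J)).hasFDerivAt.comp_hasDerivWithinAt t (hm t ht)).const_add
        1).congr_deriv ?_
      change (A t + rmul (A t) (m t).val).val = _
      rw [val_add, val_rmul, mul_add, mul_one])
  refine ⟨u, ?_, hu⟩
  rw [hu1, add_sub_cancel_left]
  exact (m N).val_mem

end Orbits

/-! ### The flow in the ideal: vector field, uniqueness, existence, orbits -/

section MainTheorem

variable {H : Type*} [NormedAddCommGroup H] [InnerProductSpace ℂ H] [CompleteSpace H]

open NormedIdeal NormedIdeal.Space

theorem exists_val_eq_opPhi_sub {J : NormedIdeal H} {a b : ℝ} {φ₁ φ₂ : ℝ → ℝ}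
    (h₁ : J.AbsLipschitzOn φ₁ a b) (h₂ : J.AbsLipschitzOn φ₂ a b) : ∃ C : ℝ, 0 ≤ C ∧
      ∀ X Y : H →L[ℂ] H, Annulus a b X → Annulus a b Y → ∀ Z : J.Space, Z.val = X - Y →
        ∃ W : J.Space, W.val = opPhi φ₁ φ₂ X - opPhi φ₁ φ₂ Y ∧ ‖W‖ ≤ C * ‖Z‖ := by
  obtain ⟨C₁, hC₁, h₁⟩ := h₁
  obtain ⟨C₂, hC₂, h₂⟩ := h₂
  refine ⟨C₁ + C₂, by positivity, fun X Y hX hY Z hZ => ?_⟩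
  obtain ⟨W₁, hW₁, n₁⟩ := h₁ X Y hX hY Z hZ
  obtain ⟨W₂, hW₂, n₂⟩ := h₂ _ _ hX.star hY.star (adj Z) (by rw [val_adj, hZ, star_sub])
  refine ⟨W₁ - W₂, ?_, ?_⟩
  · rw [val_sub, hW₁, hW₂, opPhi, opPhi]
    abel
  · have := mul_le_mul_of_nonneg_left (norm_adj_le Z) hC₂
    linarith [norm_sub_le W₁ W₂]

theorem exists_norm_opPhi_le {a b : ℝ} (ha : 0 ≤ a) {φ₁ φ₂ : ℝ → ℝ}
    (c₁ : ContinuousOn φ₁ (Icc a b)) (c₂ : ContinuousOn φ₂ (Icc a b)) :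
    ∃ M : ℝ, 0 ≤ M ∧ ∀ X : H →L[ℂ] H, Annulus a b X → ‖opPhi φ₁ φ₂ X‖ ≤ M := by
  obtain ⟨M₁, h₁⟩ := (isCompact_Icc.image_of_continuousOn c₁.norm).bddAbove
  obtain ⟨M₂, h₂⟩ := (isCompact_Icc.image_of_continuousOn c₂.norm).bddAbove
  refine ⟨max 0 M₁ + max 0 M₂, by positivity, fun X hX => (norm_sub_le _ _).trans ?_⟩
  refine add_le_add (norm_cfc_le (le_max_left _ _) fun x hx => ?_)
    (norm_cfc_le (le_max_left _ _) fun x hx => ?_)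
  · exact (h₁ ⟨x, hX.spectrum_cfcAbs_subset ha hx, rfl⟩).trans (le_max_right _ _)
  · exact (h₂ ⟨x, hX.star.spectrum_cfcAbs_subset ha hx, rfl⟩).trans (le_max_right _ _)

/-- The difference is `[φ(X) - φ(Y), X] + [φ(Y), X - Y]`: each bracket has one entry in the ideal
and one bounded in operator norm. -/
theorem exists_val_eq_lie_sub {J : NormedIdeal H} {a b : ℝ} (ha : 0 ≤ a) (hb : 0 ≤ b)
    {φ₁ φ₂ : ℝ → ℝ} (c₁ : ContinuousOn φ₁ (Icc a b)) (c₂ : ContinuousOn φ₂ (Icc a b))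
    (h₁ : J.AbsLipschitzOn φ₁ a b) (h₂ : J.AbsLipschitzOn φ₂ a b) : ∃ K : ℝ, 0 ≤ K ∧
      ∀ X Y : H →L[ℂ] H, Annulus a b X → Annulus a b Y → ∀ Z : J.Space, Z.val = X - Y →
        ∃ V : J.Space, V.val = ⁅opPhi φ₁ φ₂ X, X⁆ - ⁅opPhi φ₁ φ₂ Y, Y⁆ ∧ ‖V‖ ≤ K * ‖Z‖ := by
  obtain ⟨C, hC, h⟩ := exists_val_eq_opPhi_sub h₁ h₂
  obtain ⟨M, hM, hMX⟩ := exists_norm_opPhi_le (H := H) ha c₁ c₂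
  refine ⟨2 * (C * b) + 2 * M, by positivity, fun X Y hX hY Z hZ => ?_⟩
  obtain ⟨W, hW, hWn⟩ := h X Y hX hY Z hZ
  set P := opPhi φ₁ φ₂ Y
  have hP := hMX Y hY
  refine ⟨(rmul W X - lmul X W) + (lmul P Z - rmul Z P), ?_, ?_⟩
  · simp only [val_add, val_sub, val_rmul, val_lmul, hW, hZ, Ring.lie_def]
    noncomm_ring
  · have k0 : ‖W‖ * ‖X‖ ≤ C * ‖Z‖ * b :=
      mul_le_mul hWn hX.norm_le (norm_nonneg _) (by positivity)
    have k1 : ‖rmul W X‖ ≤ C * ‖Z‖ * b := (norm_rmul_le _ _).trans k0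
    have k2 : ‖lmul X W‖ ≤ C * ‖Z‖ * b := (norm_lmul_le _ _).trans ((mul_comm _ _).trans_le k0)
    have k3 : ‖lmul P Z‖ ≤ M * ‖Z‖ := (norm_lmul_le _ _).trans (by gcongr)
    have k4 : ‖rmul Z P‖ ≤ ‖Z‖ * M := (norm_rmul_le _ _).trans (by gcongr)
    refine (norm_add_le _ _).trans ((add_le_add (norm_sub_le _ _) (norm_sub_le _ _)).trans ?_)
    linarith

/-- The vector field `Z ↦ [φ(T + Z), T + Z]` on the ideal. -/
theorem exists_field {J : NormedIdeal H} {a b : ℝ} (ha : 0 ≤ a) (hb : 0 ≤ b)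
    {φ₁ φ₂ : ℝ → ℝ} (c₁ : ContinuousOn φ₁ (Icc a b)) (c₂ : ContinuousOn φ₂ (Icc a b))
    (h₁ : J.AbsLipschitzOn φ₁ a b) (h₂ : J.AbsLipschitzOn φ₂ a b) {T : H →L[ℂ] H}
    (hT : Annulus a b T) (hcomm : ⁅opPhi φ₁ φ₂ T, T⁆ ∈ J.toSubmodule) :
    ∃ (v : J.Space → J.Space) (K : ℝ), 0 ≤ K ∧
      (∀ Z, Annulus a b (T + Z.val) → (v Z).val = ⁅opPhi φ₁ φ₂ (T + Z.val), T + Z.val⁆) ∧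
      ∀ Z Z', Annulus a b (T + Z.val) → Annulus a b (T + Z'.val) →
        ‖v Z - v Z'‖ ≤ K * ‖Z - Z'‖ := by
  classical
  obtain ⟨K, hK, h⟩ := exists_val_eq_lie_sub (J := J) ha hb c₁ c₂ h₁ h₂
  have hex : ∀ Z : J.Space, ∃ W : J.Space, Annulus a b (T + Z.val) →
      W.val = ⁅opPhi φ₁ φ₂ (T + Z.val), T + Z.val⁆ := fun Z => by
    by_cases hZ : Annulus a b (T + Z.val)
    · obtain ⟨V, hV, -⟩ := h _ T hZ hT Z (by abel)
      -- The bracket at `T + Z` is its difference from the bracket at `T`, plus `[φ(T), T]`, which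
      -- lies in the ideal by hypothesis. Outside the annulus the value is arbitrary.
      refine ⟨V + mk _ hcomm, fun _ => ?_⟩
      rw [val_add, hV, val_mk, sub_add_cancel]
    · exact ⟨0, fun h => absurd h hZ⟩
  choose v hv using hex
  refine ⟨v, K, hK, hv, fun Z Z' hZ hZ' => ?_⟩
  obtain ⟨V, hV, hVn⟩ := h _ _ hZ hZ' (Z - Z') (by rw [val_sub]; abel)
  have e : v Z - v Z' = V := val_injective (by rw [val_sub, hv Z hZ, hv Z' hZ', hV])
  rw [e]
  exact hVn

theorem IsGlobalSolution.annulus {J : NormedIdeal H} {a b : ℝ} (ha : 0 ≤ a) (hb : 0 ≤ b)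
    {φ₁ φ₂ : ℝ → ℝ} {T : H →L[ℂ] H} {X : ℝ → (H →L[ℂ] H)}
    (h : IsGlobalSolution J a b φ₁ φ₂ T X) {t : ℝ} (ht : 0 ≤ t) : Annulus a b (X t) :=
  .of_spectrum ha hb (h.spectrum_abs t ht) (h.spectrum_abs_star t ht)

/-- The derivative in the ideal norm is also the derivative in operator norm, so the two agree and
the equation lifts along the injective inclusion. -/
theorem IsGlobalSolution.exists_field_solution {J : NormedIdeal H} {a b : ℝ} (ha : 0 ≤ a)
    (hb : 0 ≤ b) {φ₁ φ₂ : ℝ → ℝ} {T : H →L[ℂ] H} {X : ℝ → (H →L[ℂ] H)}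
    (h : IsGlobalSolution J a b φ₁ φ₂ T X) {v : J.Space → J.Space}
    (hv : ∀ Z : J.Space, Annulus a b (T + Z.val) →
      (v Z).val = ⁅opPhi φ₁ φ₂ (T + Z.val), T + Z.val⁆) :
    ∃ Z : ℝ → J.Space, Z 0 = 0 ∧ (∀ t, 0 ≤ t → X t = T + (Z t).val) ∧
      ∀ t, 0 ≤ t → HasDerivWithinAt Z (v (Z t)) (Ici 0) t := by
  obtain ⟨Z, hZ, hd⟩ := h.contDiff
  have hXZ : ∀ t, 0 ≤ t → X t = T + (Z t).val := fun t ht => by rw [hZ t ht]; abel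
  refine ⟨Z, val_injective ?_, hXZ, fun t ht => ?_⟩
  · rw [hZ 0 le_rfl, h.initial, sub_self, val_zero]
  · have h1 := ((hd.differentiableOn one_ne_zero) t ht).hasDerivWithinAt
    have h2 : HasDerivWithinAt X (derivWithin Z (Ici 0) t).val (Ici 0) t := by
      have h3 := ((valR (J := J)).hasFDerivAt.comp_hasDerivWithinAt t h1).const_add T
      exact h3.congr (fun s hs => hXZ s hs) (hXZ t ht)
    have h4 := (uniqueDiffOn_Ici (0 : ℝ) t ht).eq_deriv _ h2 (h.hasDeriv t ht)
    have h5 : derivWithin Z (Ici 0) t = v (Z t) := val_injective (by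
      rw [h4, hv _ (by rw [← hXZ t ht]; exact h.annulus ha hb ht), ← hXZ t ht])
    rw [← h5]
    exact h1

theorem IsGlobalSolution.eqOn {J : NormedIdeal H} {a b : ℝ} (ha : 0 ≤ a) (hb : 0 ≤ b)
    {φ₁ φ₂ : ℝ → ℝ} {T : H →L[ℂ] H} {X Y : ℝ → (H →L[ℂ] H)}
    (hX : IsGlobalSolution J a b φ₁ φ₂ T X) (hY : IsGlobalSolution J a b φ₁ φ₂ T Y)
    {v : J.Space → J.Space} {K : ℝ} (hK : 0 ≤ K)
    (hv : ∀ Z : J.Space, Annulus a b (T + Z.val) →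
      (v Z).val = ⁅opPhi φ₁ φ₂ (T + Z.val), T + Z.val⁆)
    (hvK : ∀ Z Z' : J.Space, Annulus a b (T + Z.val) → Annulus a b (T + Z'.val) →
        ‖v Z - v Z'‖ ≤ K * ‖Z - Z'‖) : EqOn Y X (Ici 0) := by
  obtain ⟨Z, hZ0, hXZ, hZ⟩ := hX.exists_field_solution ha hb hv
  obtain ⟨W, hW0, hYW, hW⟩ := hY.exists_field_solution ha hb hv
  intro t ht
  have key : EqOn W Z (Icc 0 t) := by
    refine ODE_solution_unique_of_mem_Icc_right (v := fun _ => v) (K := K.toNNReal)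
      (s := fun _ => {Z | Annulus a b (T + Z.val)}) (fun _ _ => ?_)
      (fun s hs => ((hW s hs.1).mono Icc_subset_Ici_self).continuousWithinAt)
      (fun s hs => (hW s hs.1).mono (Ici_subset_Ici.2 hs.1)) (fun s hs => ?_)
      (fun s hs => ((hZ s hs.1).mono Icc_subset_Ici_self).continuousWithinAt)
      (fun s hs => (hZ s hs.1).mono (Ici_subset_Ici.2 hs.1)) (fun s hs => ?_) (hW0.trans hZ0.symm)
    · refine LipschitzOnWith.of_dist_le_mul fun Z hZ Z' hZ' => ?_
      rw [dist_eq_norm, dist_eq_norm, Real.coe_toNNReal _ hK]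
      exact hvK Z Z' hZ hZ'
    · change Annulus a b (T + (W s).val)
      rw [← hYW s hs.1]
      exact hY.annulus ha hb hs.1
    · change Annulus a b (T + (Z s).val)
      rw [← hXZ s hs.1]
      exact hX.annulus ha hb hs.1
  rw [hXZ t ht, hYW t ht, key ⟨ht, le_rfl⟩]

/-- The cutoff function equal to one on `S`, vanishing at distance `δ` of `S`. -/
def distCutoff {E : Type*} [PseudoMetricSpace E] (S : Set E) (δ : ℝ) (x : E) : ℝ :=
  max 0 (1 - Metric.infDist x S / δ)

theorem abs_distCutoff_sub_le {E : Type*} [NormedAddCommGroup E] (S : Set E) {δ : ℝ} (hδ : 0 < δ)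
    (x y : E) : |distCutoff S δ x - distCutoff S δ y| ≤ δ⁻¹ * ‖x - y‖ := by
  rw [distCutoff, distCutoff, max_comm 0, max_comm 0]
  refine (abs_max_sub_max_le_abs _ _ _).trans ?_
  rw [sub_sub_sub_cancel_left, ← sub_div, abs_div, abs_of_pos hδ, div_eq_inv_mul, norm_sub_rev]
  gcongr
  have := (Metric.lipschitz_infDist_pt S).dist_le_mul y x
  rwa [NNReal.coe_one, one_mul, Real.dist_eq, dist_eq_norm] at this

/-- The cut-off equation has a global solution, which is a time change of the flow with speed `χ`.
Invariance of the inner annulus forces `χ = 1` along it. -/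
theorem exists_solution {J : NormedIdeal H} [Nontrivial H] {a b α β δ : ℝ} (ha : 0 ≤ a)
    (hab : a ≤ b) (hα : α ≤ 0 ∨ 0 < a ∧ 0 < α) {φ₁ φ₂ : ℝ → ℝ}
    (c₁ : ContinuousOn φ₁ (Icc a b)) (c₂ : ContinuousOn φ₂ (Icc a b))
    (m₁ : MonotoneOn φ₁ (Icc a b)) (m₂ : MonotoneOn φ₂ (Icc a b)) (hδ : 0 < δ)
    (hαβ : ∀ A B : H →L[ℂ] H, Annulus α β A → ‖B - A‖ < δ → Annulus a b B) {T : H →L[ℂ] H}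
    (hT : Annulus α β T) {v : J.Space → J.Space} {K : ℝ} (hK : 0 ≤ K)
    (hv : ∀ Z : J.Space, Annulus a b (T + Z.val) →
      (v Z).val = ⁅opPhi φ₁ φ₂ (T + Z.val), T + Z.val⁆)
    (hvK : ∀ Z Z' : J.Space, Annulus a b (T + Z.val) → Annulus a b (T + Z'.val) →
        ‖v Z - v Z'‖ ≤ K * ‖Z - Z'‖) :
    ∃ X : ℝ → (H →L[ℂ] H), IsGlobalSolution J a b φ₁ φ₂ T X := by
  set S : Set J.Space := {Z | Annulus α β (T + Z.val)} with hS
  set χ : J.Space → ℝ := distCutoff S δ with hχ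
  have h0S : (0 : J.Space) ∈ S := by
    change Annulus α β (T + (0 : J.Space).val)
    rwa [val_zero, add_zero]
  have hαβ' : ∀ A : H →L[ℂ] H, Annulus α β A → Annulus a b A := fun A hA =>
    hαβ A A hA (by rwa [sub_self, norm_zero])
  -- The cutoff measures distance in the ideal norm, which dominates the operator norm used in the
  -- margin `δ`.
  have hχmem : ∀ Z, χ Z ≠ 0 → Annulus a b (T + Z.val) := fun Z hZ => by
    have h1 : Metric.infDist Z S < δ := by
      by_contra! h
      refine hZ (max_eq_left ?_)
      rw [sub_nonpos, one_le_div hδ]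
      exact h
    obtain ⟨Z', hZ', hd⟩ := (Metric.infDist_lt_iff ⟨0, h0S⟩).1 h1
    refine hαβ _ _ hZ' ?_
    rw [add_sub_add_left_eq_sub, ← val_sub]
    rw [dist_eq_norm] at hd
    exact (norm_val_le _).trans_lt hd
  have hχ1 : ∀ Z ∈ S, χ Z = 1 := fun Z hZ => by
    rw [hχ, distCutoff, Metric.infDist_zero_of_mem hZ, zero_div, sub_zero, max_eq_right zero_le_one]
  have h0 : Annulus a b (T + (0 : J.Space).val) := hαβ' _ h0S
  have hfield : ∀ N, IsCutoffField (fun _ => v) χ N K ‖v 0‖ δ⁻¹ := fun N => by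
    refine ⟨hK, norm_nonneg _, (inv_pos.2 hδ).le, fun _ => le_max_left _ _, fun Z => ?_,
      abs_distCutoff_sub_le S hδ, fun _ _ Z Z' hZ hZ' => hvK Z Z' (hχmem Z hZ) (hχmem Z' hZ'),
      fun _ _ Z hZ => ?_, fun _ _ => continuousOn_const⟩
    · refine max_le zero_le_one (sub_le_self _ ?_)
      have := Metric.infDist_nonneg (x := Z) (s := S)
      positivity
    · have h1 := hvK Z 0 (hχmem Z hZ) h0
      rw [sub_zero] at h1
      have h2 : ‖v Z‖ ≤ ‖v Z - v 0‖ + ‖v 0‖ := by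
        simpa using norm_add_le (v Z - v 0) (v 0)
      linarith
  obtain ⟨Z, hZ0, hZ⟩ := IsCutoffField.exists_Ici hfield 0
  have hder : ∀ t, 0 ≤ t → HasDerivWithinAt (fun t => T + (Z t).val)
      (χ (Z t) • ⁅opPhi φ₁ φ₂ (T + (Z t).val), T + (Z t).val⁆) (Ici 0) t := fun t ht => by
    refine (((valR (J := J)).hasFDerivAt.comp_hasDerivWithinAt t (hZ t ht)).const_add
      T).congr_deriv ?_
    rw [map_smul]
    by_cases h : χ (Z t) = 0
    · rw [h, zero_smul, zero_smul]
    · rw [← hv _ (hχmem _ h)]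
      rfl
  have hinv : ∀ t, 0 ≤ t → Annulus α β (T + (Z t).val) := fun t ht =>
    annulus_of_flow (X := fun t => T + (Z t).val) (c := fun t => χ (Z t)) ha hab hα c₁ c₂ m₁ m₂ hδ
      hαβ (fun t => le_max_left _ _) (by
        rw [hZ0]
        exact h0S) hder ht
  have hZ1 : ∀ t, 0 ≤ t → HasDerivWithinAt Z (v (Z t)) (Ici 0) t := fun t ht => by
    have := hZ t ht
    rwa [hχ1 _ (hinv t ht), one_smul] at this
  have hcont : ContinuousOn Z (Ici 0) := fun t ht => (hZ1 t ht).continuousWithinAt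
  refine ⟨fun t => T + (Z t).val, ?_, fun t ht => ?_, fun t ht => ?_, fun t ht => ?_, Z,
    fun t ht => (add_sub_cancel_left _ _).symm, ?_⟩
  · rw [hZ0, val_zero, add_zero]
  · exact (hαβ' _ (hinv t ht)).spectrum_cfcAbs_subset ha
  · exact (hαβ' _ (hinv t ht)).star.spectrum_cfcAbs_subset ha
  · have := hder t ht
    rwa [hχ1 _ (hinv t ht), one_smul] at this
  · rw [contDiffOn_one_iff_derivWithin (uniqueDiffOn_Ici 0)]
    refine ⟨fun t ht => (hZ1 t ht).differentiableWithinAt, ?_⟩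
    have hc : ContinuousOn (fun t => v (Z t)) (Ici 0) :=
      hcont.of_norm_sub_le (C := K) fun s hs t ht =>
        hvK _ _ (hαβ' _ (hinv s hs)) (hαβ' _ (hinv t ht))
    exact hc.congr fun t ht => (hZ1 t ht).derivWithin (uniqueDiffOn_Ici 0 t ht)

theorem exists_Icc_of_isCompact {K : Set ℝ} (hK : IsCompact K) {a b : ℝ} (hab : a < b)
    (h : K ⊆ Ioo a b) : ∃ α β, a < α ∧ α ≤ β ∧ β < b ∧ K ⊆ Icc α β := by
  rcases K.eq_empty_or_nonempty with rfl | hne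
  · obtain ⟨c, hc⟩ := exists_between hab
    exact ⟨c, c, hc.1, le_rfl, hc.2, empty_subset _⟩
  · obtain ⟨α, hα, hα'⟩ := hK.exists_isLeast hne
    obtain ⟨β, hβ, hβ'⟩ := hK.exists_isGreatest hne
    exact ⟨α, β, (h hα).1, hα' hβ, (h hβ).2, fun x hx => ⟨hα' hx, hβ' hx⟩⟩

theorem exists_annulus_of_pos {a b : ℝ} (ha : 0 < a) (hab : a < b) {T : H →L[ℂ] H}
    (h : spectrum ℝ (CFC.abs T) ⊆ Ioo a b) (h' : spectrum ℝ (CFC.abs (star T)) ⊆ Ioo a b) :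
    ∃ α β δ : ℝ, 0 < α ∧ 0 < δ ∧ Annulus α β T ∧
      ∀ A B : H →L[ℂ] H, Annulus α β A → ‖B - A‖ < δ → Annulus a b B := by
  obtain ⟨α, β, hα, hle, hβ, hs⟩ := exists_Icc_of_isCompact
    ((spectrum.isCompact (𝕜 := ℝ) (CFC.abs T)).union (spectrum.isCompact (CFC.abs (star T)))) hab
    (union_subset h h')
  refine ⟨α, β, min (α - a) (b - β), ha.trans hα, lt_min (sub_pos.2 hα) (sub_pos.2 hβ),
    .of_spectrum (ha.trans hα).le (ha.trans (hα.trans_le hle)).le (subset_union_left.trans hs)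
      (subset_union_right.trans hs), fun A B hA hBA => (hA.of_norm_sub_le hBA.le).mono ?_ ?_⟩
  · linarith [min_le_left (α - a) (b - β)]
  · linarith [min_le_right (α - a) (b - β)]

theorem exists_annulus_of_zero {b : ℝ} (hb : 0 < b) {T : H →L[ℂ] H}
    (h : spectrum ℝ (CFC.abs T) ⊆ Ico 0 b) (h' : spectrum ℝ (CFC.abs (star T)) ⊆ Ico 0 b) :
    ∃ β δ : ℝ, 0 < δ ∧ Annulus 0 β T ∧
      ∀ A B : H →L[ℂ] H, Annulus 0 β A → ‖B - A‖ < δ → Annulus 0 b B := by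
  have hsub : spectrum ℝ (CFC.abs T) ∪ spectrum ℝ (CFC.abs (star T)) ⊆ Ico 0 b := union_subset h h'
  -- Only the upper margin matters here; `-1` is an arbitrary left endpoint below `0`, and `max 0 β`
  -- keeps the bound non-negative.
  obtain ⟨α, β, hα, hle, hβ, hs⟩ := exists_Icc_of_isCompact
    ((spectrum.isCompact (𝕜 := ℝ) (CFC.abs T)).union (spectrum.isCompact (CFC.abs (star T))))
    (by linarith : -1 < b) (hsub.trans fun x hx => ⟨by linarith [hx.1], hx.2⟩)
  have hmax : max 0 β < b := max_lt hb hβ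
  have hs' := fun x hx => (⟨(hsub hx).1, (hs hx).2.trans (le_max_right 0 β)⟩ : x ∈ Icc 0 (max 0 β))
  refine ⟨max 0 β, b - max 0 β, sub_pos.2 hmax,
    .of_spectrum le_rfl (le_max_left _ _) (fun x hx => hs' x (.inl hx))
      (fun x hx => hs' x (.inr hx)), fun A B hA hBA => .of_nonpos le_rfl ?_⟩
  have := (hA.of_norm_sub_le hBA.le).norm_le
  linarith

/-- The generator `φ(X(t))` is continuous by the Lipschitz bound. Its difference from `φ(T)` always
lies in the ideal, so `φ(T) ∈ J` puts the whole generator there, continuously in the ideal norm. -/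
theorem IsGlobalSolution.mem_orbits {J : NormedIdeal H} {a b : ℝ} (ha : 0 ≤ a) (hb : 0 ≤ b)
    {φ₁ φ₂ : ℝ → ℝ} (h₁ : J.AbsLipschitzOn φ₁ a b) (h₂ : J.AbsLipschitzOn φ₂ a b)
    {T : H →L[ℂ] H} {X : ℝ → (H →L[ℂ] H)} (h : IsGlobalSolution J a b φ₁ φ₂ T X) :
    (∀ t, 0 ≤ t → X t ∈ similarityOrbit T) ∧
      (opPhi φ₁ φ₂ T ∈ J.toSubmodule → ∀ t, 0 ≤ t → X t ∈ J.orbit T) := by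
  obtain ⟨C, -, hφ⟩ := exists_val_eq_opPhi_sub h₁ h₂
  obtain ⟨Z, hZ, hd⟩ := h.contDiff
  have key : ∀ s ∈ Ici (0 : ℝ), ∀ t ∈ Ici (0 : ℝ), ∃ W : J.Space,
      W.val = opPhi φ₁ φ₂ (X s) - opPhi φ₁ φ₂ (X t) ∧ ‖W‖ ≤ C * ‖Z s - Z t‖ := fun s hs t ht =>
    hφ _ _ (h.annulus ha hb hs) (h.annulus ha hb ht) _ (by
      rw [val_sub, hZ s hs, hZ t ht, sub_sub_sub_cancel_right])
  refine ⟨fun t ht => ?_, fun hT => ?_⟩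
  · rw [← h.initial]
    refine mem_similarityOrbit_of_lie_flow (A := fun t => opPhi φ₁ φ₂ (X t))
      (hd.continuousOn.of_norm_sub_le (C := C) fun s hs t ht => ?_) h.hasDeriv ht
    obtain ⟨W, hW, hn⟩ := key s hs t ht
    rw [← hW]
    exact (norm_val_le W).trans hn
  · have hA : ∀ t, ∃ A : J.Space, 0 ≤ t → A.val = opPhi φ₁ φ₂ (X t) := fun t => by
      by_cases ht : 0 ≤ t
      · obtain ⟨W, hW, -⟩ := key t ht 0 self_mem_Ici
        refine ⟨W + Space.mk _ hT, fun _ => ?_⟩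
        rw [val_add, val_mk, hW, h.initial, sub_add_cancel]
      · exact ⟨0, fun h => absurd h ht⟩
    choose A hA using hA
    intro t ht
    rw [← h.initial]
    refine mem_orbit_of_lie_flow (A := A)
      (hd.continuousOn.of_norm_sub_le (C := C) fun s hs t ht => ?_) (fun t ht => ?_) ht
    · obtain ⟨W, hW, hn⟩ := key s hs t ht
      have e : A s - A t = W := val_injective (by rw [val_sub, hA s hs, hA t ht, hW])
      rw [e]
      exact hn
    · rw [hA t ht]
      exact h.hasDeriv t ht

end MainTheorem

end

theorem mainTheorem8 {H : Type*} [NormedAddCommGroup H] [InnerProductSpace ℂ H] [CompleteSpace H]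
    [TopologicalSpace.SeparableSpace H] (hH : ¬ FiniteDimensional ℂ H)
    (J : NormedIdeal H) (a b : ℝ) (ha : 0 ≤ a) (hab : a < b) (φ₁ φ₂ : ℝ → ℝ)
    (hφ : ConditionC0 a b φ₁ φ₂) (T : H →L[ℂ] H)
    (hpos : 0 < a →
      J.LipschitzFunctionOn φ₁ a b ∧ J.LipschitzFunctionOn φ₂ a b ∧
      spectrum ℝ (CFC.abs T) ⊆ Set.Ioo a b ∧ spectrum ℝ (CFC.abs (star T)) ⊆ Set.Ioo a b)
    (hzero : a = 0 →
      J.LipschitzFunctionOn (fun x => φ₁ |x|) (-b) b ∧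
      J.LipschitzFunctionOn (fun x => φ₂ |x|) (-b) b ∧
      spectrum ℝ (CFC.abs T) ⊆ Set.Ico 0 b ∧ spectrum ℝ (CFC.abs (star T)) ⊆ Set.Ico 0 b)
    (hcomm : ⁅opPhi φ₁ φ₂ T, T⁆ ∈ J.toSubmodule) :
    ∃ X : ℝ → (H →L[ℂ] H),
      IsGlobalSolution J a b φ₁ φ₂ T X ∧
      (∀ Y : ℝ → (H →L[ℂ] H), IsGlobalSolution J a b φ₁ φ₂ T Y → Set.EqOn Y X (Set.Ici 0)) ∧
      (∀ t, 0 ≤ t → X t ∈ similarityOrbit T) ∧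
      (opPhi φ₁ φ₂ T ∈ J.toSubmodule → ∀ t, 0 ≤ t → X t ∈ J.orbit T) := by
  have : Nontrivial H := by
    by_contra hn
    rw [not_nontrivial_iff_subsingleton] at hn
    exact hH inferInstance
  have hb : 0 < b := ha.trans_lt hab
  have c₁ := hφ.continuousOn_fst
  have c₂ := hφ.continuousOn_snd
  obtain ⟨α, β, δ, hα, hδ, hT, hαβ, h₁, h₂⟩ : ∃ α β δ : ℝ, (α ≤ 0 ∨ 0 < a ∧ 0 < α) ∧ 0 < δ ∧
      Annulus α β T ∧ (∀ A B : H →L[ℂ] H, Annulus α β A → ‖B - A‖ < δ → Annulus a b B) ∧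
      J.AbsLipschitzOn φ₁ a b ∧ J.AbsLipschitzOn φ₂ a b := by
    rcases ha.eq_or_lt with rfl | ha0
    · obtain ⟨h₁, h₂, s₁, s₂⟩ := hzero rfl
      obtain ⟨β, δ, hδ, hT, h⟩ := exists_annulus_of_zero hb s₁ s₂
      exact ⟨0, β, δ, .inl le_rfl, hδ, hT, h, h₁.absLipschitzOn_zero hH c₁,
        h₂.absLipschitzOn_zero hH c₂⟩
    · obtain ⟨h₁, h₂, s₁, s₂⟩ := hpos ha0
      obtain ⟨α, β, δ, hα, hδ, hT, h⟩ := exists_annulus_of_pos ha0 hab s₁ s₂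
      exact ⟨α, β, δ, .inr ⟨ha0, hα⟩, hδ, hT, h, h₁.absLipschitzOn_of_pos ha0 hab.le,
        h₂.absLipschitzOn_of_pos ha0 hab.le⟩
  have hTab : Annulus a b T := hαβ T T hT (by rwa [sub_self, norm_zero])
  obtain ⟨v, K, hK, hv, hvK⟩ := exists_field ha hb.le c₁ c₂ h₁ h₂ hTab hcomm
  obtain ⟨X, hX⟩ := exists_solution ha hab.le hα c₁ c₂ hφ.monotoneOn_fst hφ.monotoneOn_snd hδ hαβ
    hT hK hv hvK
  obtain ⟨hO, hOJ⟩ := hX.mem_orbits ha hb.le h₁ h₂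
  exact ⟨X, hX, fun Y hY => hX.eqOn ha hb.le hY hK hv hvK, hO, hOJ⟩
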